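/- **Definitions.** A drawing of a graph places its nodes in the Euclidean plane, edges being straight segments. It is *greedy* if for all distinct nodes $s,t$ some neighbour $u$ of $s$ satisfies $|ut|<|st|$. Let $T'$ be a finite tree with a root $r$ of degree $1$, let $v$ be the neighbour of $r$, and orient every edge other than $rv$ away from the root. In a greedy drawing of $T'$ (or of a tree containing $T'$), let $a_1b_1$ and $a_2b_2$ be the edges of $T'$ other than $rv$, with $a_j$ closer to the root than $b_j$, whose directions $\overrightarrow{a_jb_j}$ are closest to the direction $\overrightarrow{vr}$ clockwise (for $j=1$) and counterclockwise (for $j=2$). Let $\tau\in(0^\circ,360^\circ]$ be the counterclockwise turn from $\overrightarrow{a_1b_1}$ through $\overrightarrow{vr}$ to $\overrightarrow{a_2b_2}$. The size of the *opening angle* of $T'$ is $|\angle T'|=\tau-180^\circ$; if it is positive, it is the angle of the cone in which the two half-planes bounded by the perpendicular bisectors of $a_jb_j$ and containing $a_j$ intersect. If $rv$ is the only edge of $T'$, then $|\angle T'|=180^\circ$. If $T'$ has at most two edges, then $|\angle T'|=180^\circ$ in each greedy drawing. For $\varphi_0,\dots,\varphi_{n-1}>0^\circ$ write $\{\varphi_0,\dots,\varphi_{n-1}\}\in\mathcal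 P^n$ if the star $K_{1,n}$ has a greedy drawing whose leaves $v_0,\dots,v_{n-1}$ are, in some cyclic order, the corners of a (strictly) convex $n$-gon that contains the center of the star in its interior and whose interior angle $\psi_i$ at $v_i$ satisfies $\psi_i<\varphi_i$ for all $i$. **Theorem.** Let $n\in\{3,4,5\}$, and let $T_0,\dots,T_{n-1}$ be finite trees with a common root $r$ that has degree $1$ in each $T_i$, where $T_i\cap T_j=\{r\}$ for $i\ne j$. Let $0^\circ<\varphi_i\le180^\circ$ for $i=0,\dots,n-1$. Assume that $\varphi_i=180^\circ$ if $T_i$ has at most two edges, and that otherwise for every $\varepsilon>0$ there is a greedy drawing of $T_i$ with $\varphi_i-\varepsilon\le|\angle T_i|<\varphi_i$. Then the tree $T=\bigcup_{i=0}^{n-1}T_i$ has a greedy drawing with $|\angle T_i|<\varphi_i$ for every $i$ such that $T_i$ has more than two edges if and only if $\{\varphi_0,\dots,\varphi_{n-1}\}\in\mathcal P^n$. -/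

import Mathlib

namespace GreedyTree

/-- A straight-line drawing of a graph is the placement `Γ` of its nodes in the plane `ℝ² = ℂ`.
It is greedy if for all distinct nodes `s`, `t` some neighbour of `s` is strictly closer to `t`
than `s` is. -/
def IsGreedy {W : Type*} (G : SimpleGraph W) (Γ : W → ℂ) : Prop :=
  ∀ s t : W, s ≠ t → ∃ u : W, G.Adj s u ∧ dist (Γ u) (Γ t) < dist (Γ s) (Γ t)

/-- The counterclockwise turn, in `[0, 2π)`, from the direction of the nonzero vector `z` to the
direction of the nonzero vector `w`. The clockwise turn from `z` to `w` is `ccwTurn w z`. -/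
noncomputable def ccwTurn (z w : ℂ) : ℝ :=
  toIcoMod Real.two_pi_pos 0 (w / z).arg

/-- The edges `ab` of a tree `H` with root `r`, other than the root edge `rv`, oriented such that
the start node `a` is closer to the root than the end node `b`. -/
def awayEdges {W : Type*} (H : SimpleGraph W) (r v : W) : Set (W × W) :=
  {e | H.Adj e.1 e.2 ∧ H.dist r e.1 < H.dist r e.2 ∧ e ≠ (r, v)}

open Classical in
/-- The size `|∠H|` (in radians) of the opening angle of a tree `H` with root `r` and root edge
`rv` in a drawing `Γ`.

Let `d` be the direction from `v` to `r`. The extremal edges `a₁b₁` and `a₂b₂` are those of the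
edges in `awayEdges H r v` whose directions are closest to `d` clockwise and counterclockwise,
respectively. The first infimum (a minimum over a finite set) is the counterclockwise turn from
`a₁b₁` to `d`, the second one is that from `d` to `a₂b₂`, so their sum is the counterclockwise
turn from `a₁b₁` through `d` to `a₂b₂`. If that turn is greater than `π`, then the two half-planes
bounded by the axes of the extremal edges meet in a cone of angle `turn - π`, which is the size of
the opening angle (open angle). If the turn equals `π` or is less than `π`, the value is zero
(zero angle) or negative (closed angle).
A tree that consists of its root edge only has opening angle `π`. -/
noncomputable def openingAngle {W : Type*} (H : SimpleGraph W) (r v : W) (Γ : W → ℂ) : ℝ :=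
  if (awayEdges H r v).Nonempty then
    sInf ((fun e : W × W => ccwTurn (Γ e.2 - Γ e.1) (Γ r - Γ v)) '' awayEdges H r v)
      + sInf ((fun e : W × W => ccwTurn (Γ r - Γ v) (Γ e.2 - Γ e.1)) '' awayEdges H r v)
      - Real.pi
  else Real.pi

/-- The opening angle of a subtree `S` of a graph with root `r` and root edge `rv`, in a
drawing `Γ` of `S`. -/
noncomputable def subtreeAngle {V : Type*} {G : SimpleGraph V} (S : G.Subgraph) {r v : V}
    (h : S.Adj r v) (Γ : S.verts → ℂ) : ℝ :=
  openingAngle S.coe ⟨r, h.fst_mem⟩ ⟨v, h.snd_mem⟩ Γ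

/-- `P 0, …, P (n - 1)` are the corners of a (strictly) convex polygon in counterclockwise order:
every other corner lies strictly to the left of the directed line from a corner to the next. -/
def IsConvexPolygon {n : ℕ} (P : Fin n → ℂ) : Prop :=
  ∀ k j : Fin n, j ≠ k → j ≠ finRotate n k →
    0 < ((starRingEnd ℂ) (P (finRotate n k) - P k) * (P j - P k)).im

/-- The interior angle of a convex polygon at the corner `P k`. -/
noncomputable def interiorAngle {n : ℕ} (P : Fin n → ℂ) (k : Fin n) : ℝ :=
  EuclideanGeometry.angle (P ((finRotate n).symm k)) (P k) (P (finRotate n k))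

/-- `{φ 0, …, φ (n - 1)} ∈ 𝒫ⁿ`: the star `K_{1,n}` (with center `none` and leaves `some i`) has a
greedy drawing in which the leaves, in some order `σ`, are the corners of a convex `n`-gon that
contains the center in its interior and whose interior angle at leaf `i` is less than `φ i`. -/
def InP (n : ℕ) (φ : Fin n → ℝ) : Prop :=
  ∃ Γ : Option (Fin n) → ℂ,
    IsGreedy (SimpleGraph.starGraph (none : Option (Fin n))) Γ ∧
    ∃ σ : Equiv.Perm (Fin n),
      IsConvexPolygon (fun k => Γ (some (σ k))) ∧
      Γ none ∈ interior (convexHull ℝ (Set.range fun k => Γ (some (σ k)))) ∧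
      ∀ k : Fin n, interiorAngle (fun k => Γ (some (σ k))) k < φ (σ k)

end GreedyTree

/-!
A branch `T i` enters the drawing of the rest of the tree only through the half-planes of its edges:
if `ab` is an edge directed away from the root, then all nodes that do not descend from `b` are
closer to `a` than to `b` (`IsGreedy.dist_lt`), and the extremal edges of the branch cut out the
cone whose angle is the opening angle.

*From a star to the tree.* At a leaf of the star all other leaves and the center lie in the cone
spanned by the polygon's interior angle `ψ i < φ i`. A drawing of `T i` with opening angle between
`ψ i` and `φ i` can be rotated such that its half-planes contain this cone
(`exists_rotation_of_lt_openingAngle`). Draw the root at the center and a copy of `T i` without its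
root, scaled by a small `ε`, at the leaf of `T i`. For `ε → 0` all distance comparisons become those
of the star, or those inside one branch, or say that a point of the cone lies in a half-plane
(`IsRootedUnion.exists_isGreedy`). The turn between the two extremal edges through the direction of
the root does not depend on the direction of the root edge (`ccwTurn_add_ccwTurn_eq`), so the
opening angles do not grow (`openingAngle_le_of_away_eq`).

*From the tree to a star.* With the root at the origin, the branches are replaced by points one at a
time (`IsSystem.exists_shrink`). Let `C` be the intersection of the half-planes that belong to the
edges of the other branches. If `C` is unbounded, a point of `C` far away from the root replaces the
branch, since it sees all other nodes within an arbitrarily small angle. Otherwise let `q` be a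
point of `C` that is farthest in the direction of the root edge. It is a corner of `C`, and going
along the tree one sees that the directions of all edges of the branch lie in the cone spanned by
the normal vectors of its two sides (`BranchSetting.exists_corner`); hence `q` is farther than all
interior points of `C` in the direction of each edge. If all nodes of the other branches are closer
to the root than to `q`, then a point just in front of `q` replaces the branch. If a node `y` is
not, then the branch lies on the side of the line through the root and `q` opposite to `y`
(`BranchSetting.opposite_side`), and one of the end nodes of the two extremal edges, moved away from
the root if need be, will do (`BranchSetting.exists_substitute_of_side`).

In the end every branch is a point `q i` with three half-planes (`shrunk`). The points are the
leaves of a greedily drawn star, each is exposed by a direction, and `q i` sees the others within an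
angle less than `φ i`. Sorted by argument, they are the corners of a convex polygon (`inP_of_points`). Its
interior contains the origin if there are at least four points, as two leaves of the star are never
at an angle of `π / 3` or less (`exists_dot_pos_of_star`). Three points may leave the origin
outside, but then the incenter of the triangle is a suitable center (`inP_three`).
-/

namespace GreedyTree

open Complex

/-! ### Inner and cross products, turns -/

/-- The Euclidean inner product on `ℂ = ℝ²`. -/
def dot (z w : ℂ) : ℝ := z.re * w.re + z.im * w.im

/-- The cross product on `ℂ = ℝ²`; it is positive if `w` points to the left of `z`. -/
def crs (z w : ℂ) : ℝ := z.re * w.im - z.im * w.re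

lemma dot_comm (z w : ℂ) : dot z w = dot w z := by unfold dot; ring

lemma dot_self_nonneg (z : ℂ) : 0 ≤ dot z z := by
  unfold dot; nlinarith [sq_nonneg z.re, sq_nonneg z.im]

lemma dot_self_pos {z : ℂ} (hz : z ≠ 0) : 0 < dot z z := by
  refine lt_of_le_of_ne (dot_self_nonneg z) fun h => hz ?_
  unfold dot at h
  apply Complex.ext <;> simp <;> nlinarith [sq_nonneg z.re, sq_nonneg z.im]

lemma dot_self_eq_norm_sq (z : ℂ) : dot z z = ‖z‖ ^ 2 := by
  rw [← Complex.normSq_eq_norm_sq, Complex.normSq_apply]; rfl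

lemma crs_eq_im (z w : ℂ) : crs z w = ((starRingEnd ℂ) z * w).im := by
  simp [crs]; ring

lemma inner_eq_dot (z w : ℂ) : inner ℝ z w = dot z w := by
  rw [Complex.inner]; simp [dot]; ring

lemma dot_le_norm_mul_norm (z w : ℂ) : dot z w ≤ ‖z‖ * ‖w‖ := by
  rw [← inner_eq_dot]; exact real_inner_le_norm z w

lemma norm_lt_norm_iff_dot (z w : ℂ) : ‖z‖ < ‖w‖ ↔ dot z z < dot w w := by
  rw [dot_self_eq_norm_sq, dot_self_eq_norm_sq, sq_lt_sq₀ (norm_nonneg _) (norm_nonneg _)]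

lemma dist_lt_dist_iff_dot (c d z : ℂ) :
    dist c z < dist d z ↔ dot (d - c) (z - (c + d) / 2) < 0 := by
  rw [dist_eq_norm, dist_eq_norm, norm_lt_norm_iff_dot]
  simp only [dot, sub_re, sub_im, add_re, add_im, div_ofNat_re, div_ofNat_im]
  constructor <;> intro h <;> nlinarith

lemma dot_smul_right (t : ℝ) (z w : ℂ) : dot z (t * w) = t * dot z w := by
  simp [dot]; ring

lemma dot_smul_left (t : ℝ) (z w : ℂ) : dot (t * z) w = t * dot z w := by
  simp [dot]; ring

lemma dot_add_right (z w w' : ℂ) : dot z (w + w') = dot z w + dot z w' := by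
  simp [dot]; ring

lemma dot_sub_right (z w w' : ℂ) : dot z (w - w') = dot z w - dot z w' := by
  simp [dot]; ring

lemma dot_add_left (z z' w : ℂ) : dot (z + z') w = dot z w + dot z' w := by
  simp [dot]; ring

lemma dot_sub_left (z z' w : ℂ) : dot (z - z') w = dot z w - dot z' w := by
  simp [dot]; ring

lemma dot_neg_left (z w : ℂ) : dot (-z) w = -dot z w := by
  simp [dot]; ring

lemma dot_neg_right (z w : ℂ) : dot z (-w) = -dot z w := by
  simp [dot]; ring

lemma dot_zero_right (z : ℂ) : dot z 0 = 0 := by simp [dot]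

lemma continuous_dot (z : ℂ) : Continuous (dot z) := by unfold dot; fun_prop

/-- `HasTurn d w s`: the direction of `w` arises from that of `d` by the counterclockwise turn `s`,
where `s` is any real representative modulo `2π`. -/
def HasTurn (d w : ℂ) (s : ℝ) : Prop := ∃ k : ℝ, 0 < k ∧ w = k * Complex.exp (s * I) * d

lemma HasTurn.add_int_mul {d w : ℂ} {s : ℝ} (h : HasTurn d w s) (m : ℤ) :
    HasTurn d w (s + m * (2 * Real.pi)) := by
  obtain ⟨k, hk, rfl⟩ := h
  refine ⟨k, hk, ?_⟩
  have : ((s + m * (2 * Real.pi) : ℝ) : ℂ) * I = s * I + m * (2 * Real.pi * I) := by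
    push_cast; ring
  rw [this, Complex.exp_add, Complex.exp_int_mul_two_pi_mul_I, mul_one]

lemma HasTurn.ne_zero {d w : ℂ} {s : ℝ} (h : HasTurn d w s) (hd : d ≠ 0) : w ≠ 0 := by
  obtain ⟨k, hk, rfl⟩ := h
  exact mul_ne_zero (mul_ne_zero (by exact_mod_cast hk.ne') (Complex.exp_ne_zero _)) hd

lemma hasTurn_arg {d w : ℂ} (hd : d ≠ 0) (hw : w ≠ 0) : HasTurn d w (w / d).arg := by
  refine ⟨‖w / d‖, norm_pos_iff.2 (div_ne_zero hw hd), ?_⟩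
  rw [Complex.norm_mul_exp_arg_mul_I, div_mul_cancel₀ _ hd]

lemma exists_hasTurn_mem_Ico {d w : ℂ} (hd : d ≠ 0) (hw : w ≠ 0) (x : ℝ) :
    ∃ s ∈ Set.Ico x (x + 2 * Real.pi), HasTurn d w s := by
  refine ⟨toIcoMod Real.two_pi_pos x (w / d).arg, toIcoMod_mem_Ico _ _ _, ?_⟩
  have := (hasTurn_arg hd hw).add_int_mul (-toIcoDiv Real.two_pi_pos x (w / d).arg)
  convert this using 1
  simp only [toIcoMod, zsmul_eq_mul, Int.cast_neg]; ring

lemma hasTurn_ccwTurn {d w : ℂ} (hd : d ≠ 0) (hw : w ≠ 0) : HasTurn d w (ccwTurn d w) := by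
  have := (hasTurn_arg hd hw).add_int_mul (-toIcoDiv Real.two_pi_pos 0 (w / d).arg)
  convert this using 1
  simp only [ccwTurn, toIcoMod, zsmul_eq_mul, Int.cast_neg]; ring

lemma ccwTurn_mem (d w : ℂ) : ccwTurn d w ∈ Set.Ico 0 (2 * Real.pi) := by
  have := toIcoMod_mem_Ico Real.two_pi_pos 0 (w / d).arg
  simpa [ccwTurn] using this

lemma HasTurn.dot_eq {d w w' : ℂ} {s s' : ℝ} (h : HasTurn d w s) (h' : HasTurn d w' s')
    (hd : d ≠ 0) : ∃ k : ℝ, 0 < k ∧ dot w w' = k * Real.cos (s' - s) ∧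
      crs w w' = k * Real.sin (s' - s) := by
  obtain ⟨k, hk, rfl⟩ := h
  obtain ⟨k', hk', rfl⟩ := h'
  refine ⟨k * k' * dot d d, mul_pos (mul_pos hk hk') (dot_self_pos hd), ?_, ?_⟩
  · rw [Real.cos_sub]
    simp [dot, Complex.exp_ofReal_mul_I_re, Complex.exp_ofReal_mul_I_im]; ring
  · rw [Real.sin_sub]
    simp [crs, dot, Complex.exp_ofReal_mul_I_re, Complex.exp_ofReal_mul_I_im]; ring

lemma HasTurn.dot_pos_iff {d w w' : ℂ} {s s' : ℝ} (h : HasTurn d w s) (h' : HasTurn d w' s')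
    (hd : d ≠ 0) : 0 < dot w w' ↔ 0 < Real.cos (s' - s) := by
  obtain ⟨k, hk, e, -⟩ := h.dot_eq h' hd
  rw [e]; exact mul_pos_iff_of_pos_left hk

lemma HasTurn.dot_neg_iff {d w w' : ℂ} {s s' : ℝ} (h : HasTurn d w s) (h' : HasTurn d w' s')
    (hd : d ≠ 0) : dot w w' < 0 ↔ Real.cos (s' - s) < 0 := by
  obtain ⟨k, hk, e, -⟩ := h.dot_eq h' hd
  rw [e]; constructor <;> intro h <;> nlinarith

lemma HasTurn.crs_pos_iff {d w w' : ℂ} {s s' : ℝ} (h : HasTurn d w s) (h' : HasTurn d w' s')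
    (hd : d ≠ 0) : 0 < crs w w' ↔ 0 < Real.sin (s' - s) := by
  obtain ⟨k, hk, -, e⟩ := h.dot_eq h' hd
  rw [e]; exact mul_pos_iff_of_pos_left hk

lemma hasTurn_self (d : ℂ) : HasTurn d d 0 := ⟨1, one_pos, by simp⟩

lemma HasTurn.symm {d w : ℂ} {s : ℝ} (h : HasTurn d w s) : HasTurn w d (-s) := by
  obtain ⟨k, hk, rfl⟩ := h
  refine ⟨k⁻¹, inv_pos.2 hk, ?_⟩
  have : (k : ℂ) ≠ 0 := by exact_mod_cast hk.ne'
  push_cast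
  rw [neg_mul, Complex.exp_neg]
  field_simp

lemma HasTurn.trans {d w z : ℂ} {s t : ℝ} (h : HasTurn d w s) (h' : HasTurn w z t) :
    HasTurn d z (s + t) := by
  obtain ⟨k, hk, rfl⟩ := h
  obtain ⟨k', hk', rfl⟩ := h'
  refine ⟨k' * k, mul_pos hk' hk, ?_⟩
  push_cast
  rw [add_mul, Complex.exp_add]; ring

lemma HasTurn.congr {d w : ℂ} {s t : ℝ} (h : HasTurn d w s) (e : s = t) : HasTurn d w t := e ▸ h

/-- A turn is unique up to multiples of `2π`. -/
lemma HasTurn.unique {d w : ℂ} {s t : ℝ} (h : HasTurn d w s) (h' : HasTurn d w t) (hd : d ≠ 0)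
    (hst : |s - t| < 2 * Real.pi) : s = t := by
  have h1 := (h'.symm.trans h)
  obtain ⟨k, hk, hkk⟩ := h1
  have hw := h.ne_zero hd
  have e : (1 : ℂ) = k * Complex.exp ((-t + s : ℝ) * I) := by
    have : (1 : ℂ) * w = k * Complex.exp ((-t + s : ℝ) * I) * w := by rw [one_mul]; exact hkk
    exact mul_right_cancel₀ hw this
  have h2 : Real.cos (-t + s) = 1 := by
    have hre := congrArg Complex.re e
    have him := congrArg Complex.im e
    simp only [one_re, one_im, mul_re, mul_im, ofReal_re, ofReal_im, zero_mul, sub_zero, add_zero,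
      Complex.exp_ofReal_mul_I_re, Complex.exp_ofReal_mul_I_im] at hre him
    have hs : Real.sin (-t + s) = 0 := by
      rcases mul_eq_zero.1 him.symm with h | h
      · exact absurd h hk.ne'
      · exact h
    have hc := Real.sin_sq_add_cos_sq (-t + s)
    rw [hs] at hc
    nlinarith
  rw [abs_lt] at hst
  have := (Real.cos_eq_one_iff_of_lt_of_lt (x := -t + s) (by linarith [hst.1])
    (by linarith [hst.2])).1 h2
  linarith

lemma HasTurn.ccwTurn_eq {d w : ℂ} {s : ℝ} (h : HasTurn d w s) (hd : d ≠ 0) (h0 : 0 ≤ s)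
    (h1 : s < 2 * Real.pi) : ccwTurn d w = s := by
  have hm := ccwTurn_mem d w
  refine (hasTurn_ccwTurn hd (h.ne_zero hd)).unique h hd ?_
  rw [abs_lt]; constructor <;> linarith [hm.1, hm.2]

lemma HasTurn.angle_eq {d w w' : ℂ} {s s' : ℝ} (h : HasTurn d w s) (h' : HasTurn d w' s')
    (hd : d ≠ 0) (hs : |s - s'| ≤ Real.pi) : InnerProductGeometry.angle w w' = |s - s'| := by
  wlog hss : s ≤ s' generalizing s s' w w'
  · rw [InnerProductGeometry.angle_comm, abs_sub_comm]
    exact this h' h (by rwa [abs_sub_comm]) (le_of_not_ge hss)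
  obtain ⟨k, hk, rfl⟩ := h
  obtain ⟨k', hk', rfl⟩ := h'
  have e : |s - s'| = s' - s := by rw [abs_sub_comm, abs_of_nonneg (by linarith)]
  have key : inner ℝ ((k : ℂ) * Complex.exp (s * I) * d) (k' * Complex.exp (s' * I) * d)
      = k * k' * ‖d‖ ^ 2 * Real.cos (s' - s) := by
    rw [inner_eq_dot, Real.cos_sub, ← dot_self_eq_norm_sq]
    simp [dot, Complex.exp_ofReal_mul_I_re, Complex.exp_ofReal_mul_I_im]; ring
  have hd' : ‖d‖ ≠ 0 := norm_ne_zero_iff.2 hd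
  rw [InnerProductGeometry.angle, key, e, norm_mul, norm_mul, norm_mul, norm_mul,
    Complex.norm_exp_ofReal_mul_I, Complex.norm_exp_ofReal_mul_I, Complex.norm_real,
    Complex.norm_real, Real.norm_of_nonneg hk.le, Real.norm_of_nonneg hk'.le]
  rw [show k * k' * ‖d‖ ^ 2 * Real.cos (s' - s) / (k * 1 * ‖d‖ * (k' * 1 * ‖d‖))
    = Real.cos (s' - s) by field_simp]
  exact Real.arccos_cos (by linarith) (by linarith)

/-- If `e₁` is `A` clockwise and `e₂` is `B` counterclockwise of `d`, then the directions that form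
obtuse angles with both `e₁` and `e₂` lie in an open arc of length `A + B - π`. -/
lemma exists_hasTurn_of_dot_neg {d e₁ e₂ w : ℂ} {A B : ℝ} (hd : d ≠ 0) (h₁ : HasTurn d e₁ (-A))
    (h₂ : HasTurn d e₂ B) (h0 : Real.pi < A + B)
    (hw₁ : dot e₁ w < 0) (hw₂ : dot e₂ w < 0) :
    ∃ s, HasTurn d w s ∧ Real.pi / 2 < A + s ∧ Real.pi / 2 < B - s := by
  have hw : w ≠ 0 := by rintro rfl; simp [dot] at hw₁
  obtain ⟨s, ⟨hs1, hs2⟩, hs⟩ := exists_hasTurn_mem_Ico hd hw (B - 3 * Real.pi / 2)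
  have c1 := (h₁.dot_neg_iff hs hd).1 hw₁
  have c2 := (h₂.dot_neg_iff hs hd).1 hw₂
  have hB : Real.pi / 2 < B - s := by
    by_contra hcon
    have := Real.cos_nonneg_of_neg_pi_div_two_le_of_le (x := s - B) (by linarith) (by linarith)
    linarith
  refine ⟨s, hs, ?_, hB⟩
  by_contra hcon
  have := Real.cos_nonneg_of_neg_pi_div_two_le_of_le (x := s - -A) (by linarith) (by linarith)
  linarith

lemma angle_lt_of_dot_neg {d e₁ e₂ w w' : ℂ} {A B : ℝ} (hd : d ≠ 0) (h₁ : HasTurn d e₁ (-A))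
    (h₂ : HasTurn d e₂ B) (h0 : Real.pi < A + B) (hp : A + B < 2 * Real.pi)
    (hw₁ : dot e₁ w < 0) (hw₂ : dot e₂ w < 0) (hw₁' : dot e₁ w' < 0) (hw₂' : dot e₂ w' < 0) :
    InnerProductGeometry.angle w w' < A + B - Real.pi := by
  obtain ⟨s, hs, a, b⟩ := exists_hasTurn_of_dot_neg hd h₁ h₂ h0 hw₁ hw₂
  obtain ⟨s', hs', a', b'⟩ := exists_hasTurn_of_dot_neg hd h₁ h₂ h0 hw₁' hw₂'
  have : |s - s'| < A + B - Real.pi := by rw [abs_lt]; constructor <;> linarith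
  rw [hs.angle_eq hs' hd (by linarith)]
  exact this

/-- The turn from `e₁` through `d` to `e₂` does not change if `d` is replaced by a direction that
forms obtuse angles with both `e₁` and `e₂`. -/
lemma ccwTurn_add_ccwTurn_eq {d e₁ e₂ w : ℂ} {A B : ℝ} (hd : d ≠ 0) (h₁ : HasTurn d e₁ (-A))
    (h₂ : HasTurn d e₂ B) (h0 : Real.pi < A + B) (hp : A + B < 2 * Real.pi)
    (hw₁ : dot e₁ w < 0) (hw₂ : dot e₂ w < 0) :
    ccwTurn e₁ w + ccwTurn w e₂ = A + B := by
  have hπ := Real.pi_pos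
  obtain ⟨s, hs, a, b⟩ := exists_hasTurn_of_dot_neg hd h₁ h₂ h0 hw₁ hw₂
  have t1 : HasTurn e₁ w (A + s) := (h₁.symm.trans hs).congr (by ring)
  have t2 : HasTurn w e₂ (B - s) := (hs.symm.trans h₂).congr (by ring)
  rw [t1.ccwTurn_eq (h₁.ne_zero hd) (by linarith) (by linarith),
    t2.ccwTurn_eq (hs.ne_zero hd) (by linarith) (by linarith)]
  ring

/-- If some direction `w` forms an acute angle with `d` and obtuse angles with `e₁` and `e₂`, then
the turn from `e₁` through `d` to `e₂` is greater than `π`. -/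
lemma pi_lt_ccwTurn_add_ccwTurn {d e₁ e₂ w : ℂ} (hw : 0 < dot d w)
    (hw₁ : dot e₁ w < 0) (hw₂ : dot e₂ w < 0) :
    Real.pi < ccwTurn e₁ d + ccwTurn d e₂ := by
  have hπ := Real.pi_pos
  have hd : d ≠ 0 := by rintro rfl; simp [dot] at hw
  have he₁ : e₁ ≠ 0 := by rintro rfl; simp [dot] at hw₁
  have he₂ : e₂ ≠ 0 := by rintro rfl; simp [dot] at hw₂
  have hw0 : w ≠ 0 := by rintro rfl; simp [dot] at hw
  have mA := ccwTurn_mem e₁ d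
  have mB := ccwTurn_mem d e₂
  have tA := (hasTurn_ccwTurn he₁ hd).symm
  have tB := hasTurn_ccwTurn hd he₂
  obtain ⟨s, ⟨hs1, hs2⟩, hs⟩ := exists_hasTurn_mem_Ico hd hw0 (-Real.pi)
  have c0 := ((hasTurn_self d).dot_pos_iff hs hd).1 hw
  have c1 := (tA.dot_neg_iff hs hd).1 hw₁
  have c2 := (tB.dot_neg_iff hs hd).1 hw₂
  rw [sub_zero] at c0
  have l : -(Real.pi / 2) < s := by
    by_contra hcon
    have := Real.cos_nonpos_of_pi_div_two_le_of_le (x := -s) (by linarith) (by linarith)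
    rw [Real.cos_neg] at this
    linarith
  have r : s < Real.pi / 2 := by
    by_contra hcon
    have := Real.cos_nonpos_of_pi_div_two_le_of_le (x := s) (by linarith) (by linarith)
    linarith
  have k1 : Real.pi / 2 < s + ccwTurn e₁ d := by
    by_contra hcon
    have := Real.cos_nonneg_of_neg_pi_div_two_le_of_le (x := s - -ccwTurn e₁ d)
      (by linarith [mA.1]) (by linarith)
    linarith
  have k2 : Real.pi / 2 < ccwTurn d e₂ - s := by
    by_contra hcon
    have := Real.cos_nonneg_of_neg_pi_div_two_le_of_le (x := s - ccwTurn d e₂)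
      (by linarith [mB.1]) (by linarith [mB.1])
    linarith
  linarith

/-- The directions `e` with turn at least `B` counterclockwise and at least `A` clockwise from `d`
can be rotated such that they form obtuse angles with both sides `u₁`, `u₂` of any cone of angle
less than `A + B - π`. -/
lemma exists_rotation {d u₁ u₂ : ℂ} {A B ψ : ℝ} (hd : d ≠ 0) (hu : u₁ ≠ 0)
    (hψ : HasTurn u₁ u₂ ψ) (hψ0 : 0 ≤ ψ) (hψA : ψ < A + B - Real.pi) (hAB : A + B < 2 * Real.pi) :
    ∃ ρ : ℂ, ρ ≠ 0 ∧ ∀ e : ℂ, e ≠ 0 → B ≤ ccwTurn d e → A ≤ ccwTurn e d →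
      dot (ρ * e) u₁ < 0 ∧ dot (ρ * e) u₂ < 0 := by
  have hπ := Real.pi_pos
  -- `x` is the turn from `d` to the preimage of `u₁`
  set x := ((Real.pi / 2 - A) + (B - Real.pi / 2 - ψ)) / 2 with hx
  have hx1 : Real.pi / 2 - A < x := by rw [hx]; linarith
  have hx2 : x + ψ < B - Real.pi / 2 := by rw [hx]; linarith
  set ρ := u₁ / (Complex.exp (x * I) * d) with hρ
  have hne : Complex.exp (x * I) * d ≠ 0 := mul_ne_zero (Complex.exp_ne_zero _) hd
  refine ⟨ρ, div_ne_zero hu hne, fun e he hB hA => ?_⟩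
  have mB := ccwTurn_mem d e
  have t0 := hasTurn_ccwTurn hd he
  set t := ccwTurn d e with ht
  have htu : t ≤ 2 * Real.pi - A := by
    rcases eq_or_lt_of_le mB.1 with h0 | h0
    · have : ccwTurn e d = 0 := by
        refine (t0.symm.congr ?_).ccwTurn_eq he le_rfl (by positivity)
        rw [← h0, neg_zero]
      linarith
    · have : ccwTurn e d = -t + (1 : ℤ) * (2 * Real.pi) := by
        refine (t0.symm.add_int_mul 1).ccwTurn_eq he ?_ ?_
        · push_cast; linarith [mB.2]
        · push_cast; linarith
      push_cast at this
      linarith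
  have tρ : HasTurn u₁ (ρ * e) (t - x) := by
    obtain ⟨k, hk, hke⟩ := t0
    refine ⟨k, hk, ?_⟩
    rw [hke, hρ]
    push_cast
    rw [sub_mul, Complex.exp_sub]
    field_simp
  rw [tρ.dot_neg_iff (hasTurn_self u₁) hu, tρ.dot_neg_iff hψ hu]
  have key : ∀ y : ℝ, Real.pi / 2 < y → y < 3 * Real.pi / 2 → Real.cos (-y) < 0 := by
    intro y h1 h2
    rw [Real.cos_neg]
    exact Real.cos_neg_of_pi_div_two_lt_of_lt h1 (by linarith)
  constructor
  · convert key (t - x) (by linarith) (by linarith) using 2; ring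
  · convert key (t - x - ψ) (by linarith) (by linarith) using 2; ring

/-! ### A branch in the presence of other branches -/

lemma dot_sub_half (f a b c : ℂ) :
    dot f (c - (a + b) / 2) = dot f c - (dot f a + dot f b) / 2 := by
  simp only [dot, sub_re, sub_im, add_re, add_im, div_ofNat_re, div_ofNat_im]; ring

lemma crs_smul_identity (u v w : ℂ) : (crs u w : ℂ) * v = crs v w * u + crs u v * w := by
  apply Complex.ext <;> simp [crs] <;> ring

lemma dot_mul_crs (q u v w : ℂ) :
    dot v q * crs u w = dot u q * crs v w + dot w q * crs u v := by
  simp only [dot, crs]; ring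

/-- One step of a path of edges with direction in an open cone: the direction cannot leave the cone
without crossing one of its sides or being reversed. -/
lemma cone_step {f₁ f₂ g₁ g₂ : ℂ} (h₁ : 0 < crs f₁ g₁) (h₂ : 0 < crs g₁ f₂)
    (h : 0 < crs f₁ f₂)
    (n₁ : ∀ μ ν : ℝ, 0 ≤ μ → 0 ≤ ν → f₁ ≠ μ * g₁ + ν * g₂)
    (n₂ : ∀ μ ν : ℝ, 0 ≤ μ → 0 ≤ ν → f₂ ≠ μ * g₁ + ν * g₂)
    (t₁ : -dot g₁ g₁ < 2 * dot g₁ g₂) (t₂ : -dot g₂ g₂ < 2 * dot g₁ g₂) :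
    0 < crs f₁ g₂ ∧ 0 < crs g₂ f₂ := by
  have key : crs f₁ f₂ * crs g₁ g₂ = crs g₁ f₂ * crs f₁ g₂ - crs f₁ g₁ * crs g₂ f₂ := by
    simp only [crs]; ring
  have a₁ : crs g₁ f₁ = -crs f₁ g₁ := by simp only [crs]; ring
  have a₂ : crs f₂ g₂ = -crs g₂ f₂ := by simp only [crs]; ring
  -- `g₂` is not a nonpositive multiple of `g₁`
  have anti : ∀ κ : ℝ, 0 ≤ κ → g₂ ≠ ((-κ : ℝ) : ℂ) * g₁ := by
    rintro κ hκ rfl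
    rw [dot_smul_left, dot_smul_right] at t₂
    rw [dot_smul_right] at t₁
    have := dot_self_nonneg g₁
    rcases eq_or_lt_of_le this with h0 | h0
    · rw [← h0] at t₁; simp at t₁
    · have e1 : κ < 1 / 2 := by nlinarith
      have e2 : 2 * κ * dot g₁ g₁ < κ * κ * dot g₁ g₁ := by linarith
      have e3 : 2 * κ < κ * κ := lt_of_mul_lt_mul_right e2 this
      nlinarith
  have cross₁ : crs g₁ g₂ < 0 → 0 < crs f₁ g₂ := by
    intro hX
    by_contra hc
    refine n₁ (crs f₁ g₂ / crs g₁ g₂) (crs g₁ f₁ / crs g₁ g₂)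
      (div_nonneg_of_nonpos (not_lt.1 hc) hX.le) (div_nonneg_of_nonpos (by linarith) hX.le) ?_
    have hne : (crs g₁ g₂ : ℂ) ≠ 0 := by exact_mod_cast hX.ne
    push_cast
    field_simp
    linear_combination crs_smul_identity g₁ f₁ g₂
  have cross₂ : 0 < crs g₁ g₂ → 0 < crs g₂ f₂ := by
    intro hX
    by_contra hc
    refine n₂ (crs f₂ g₂ / crs g₁ g₂) (crs g₁ f₂ / crs g₁ g₂)
      (div_nonneg (by linarith) hX.le) (div_nonneg h₂.le hX.le) ?_
    have hne : (crs g₁ g₂ : ℂ) ≠ 0 := by exact_mod_cast hX.ne'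
    push_cast
    field_simp
    linear_combination crs_smul_identity g₁ f₂ g₂
  have hc₁ : 0 < crs f₁ g₂ := by
    by_contra hc
    rcases lt_trichotomy (crs g₁ g₂) 0 with hX | hX | hX
    · exact hc (cross₁ hX)
    · refine anti (-(crs f₁ g₂ / crs f₁ g₁))
        (neg_nonneg.2 (div_nonpos_of_nonpos_of_nonneg (not_lt.1 hc) h₁.le)) ?_
      have hne : (crs f₁ g₁ : ℂ) ≠ 0 := by exact_mod_cast h₁.ne'
      have e := crs_smul_identity f₁ g₁ g₂
      rw [hX] at e
      rw [neg_neg]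
      push_cast at e ⊢
      field_simp
      linear_combination -e
    · have := cross₂ hX
      nlinarith [mul_pos h hX, mul_pos h₁ this]
  refine ⟨hc₁, ?_⟩
  by_contra hc
  rcases lt_or_ge 0 (crs g₁ g₂) with hX | hX
  · exact hc (cross₂ hX)
  · nlinarith [mul_pos h₂ hc₁]

/-- A drawing `x` of a rooted tree with root `r` at the origin and root edge `r v`, such that the
nodes satisfy those conditions of a greedy drawing that are needed below. `R` is the set of edges of
the tree, directed away from the root. -/
structure RootedDrawing {W : Type*} (x : W → ℂ) (R : W → W → Prop) (r v : W) : Prop where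
  root : x r = 0
  root_edge : R r v
  /-- Every edge is reached from the root edge by steps to consecutive edges. -/
  induct : ∀ Q : W → W → Prop, Q r v → (∀ s t u, R s t → R t u → Q s t → Q t u) →
    ∀ s t, R s t → Q s t
  /-- The root is in the half-plane of each edge. -/
  root_mem : ∀ s t, R s t → dot (x t - x s) (0 - (x s + x t) / 2) < 0
  /-- The end nodes of a path of two edges have a greater distance than those of the edges. -/
  turn : ∀ s t u, R s t → R t u →
    -dot (x t - x s) (x t - x s) < 2 * dot (x t - x s) (x u - x t) ∧
    -dot (x u - x t) (x u - x t) < 2 * dot (x t - x s) (x u - x t)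
  /-- `x t` is closer to its parent `x s` than to the root. -/
  near_parent : ∀ s t, R s t → s ≠ r → dot (x s) (x s) < 2 * dot (x s) (x t)

/-- A rooted tree drawn in the presence of other branches at the root. The other branches enter
through the set `Y` of their nodes and a set `N` of pairs `(p, f)`, each of which stands for the
open half-plane `{z | f · (z - p) < 0}` that has to contain whatever belongs to different branches;
an edge `cd` gives the pair `((c + d) / 2, d - c)`. -/
structure BranchSetting {W : Type*} (x : W → ℂ) (R : W → W → Prop) (r v : W) (Y : Set ℂ)
    (N : Set (ℂ × ℂ)) : Prop extends RootedDrawing x R r v where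
  finite_Y : Y.Finite
  finite_N : N.Finite
  zero_mem : ∀ n ∈ N, 0 < dot n.2 n.1
  /-- A point in the half-planes of the other branches is at least as close to the root as to their
  nodes. -/
  near_zero : ∀ z, (∀ n ∈ N, dot n.2 (z - n.1) ≤ 0) → ∀ y ∈ Y, 2 * dot y z ≤ dot y y
  node_mem : ∀ n ∈ N, ∀ s t, R s t → dot n.2 (x t - n.1) < 0
  /-- The half-planes of the edges of the branch contain the base points of those of the other
  branches. -/
  base_mem : ∀ n ∈ N, ∀ s t, R s t → dot (x t - x s) (n.1 - (x s + x t) / 2) < 0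
  other_mem : ∀ y ∈ Y, ∀ s t, R s t → dot (x t - x s) (y - (x s + x t) / 2) < 0

namespace BranchSetting

variable {W : Type*} {x : W → ℂ} {R : W → W → Prop} {r v : W} {Y : Set ℂ} {N : Set (ℂ × ℂ)}

lemma far (S : BranchSetting x R r v Y N) {y : ℂ} (hy : y ∈ Y) {s t : W} (h : R s t) :
    2 * dot y (x t) < dot (x t) (x t) := by
  refine S.induct (fun _ t => 2 * dot y (x t) < dot (x t) (x t)) ?_ ?_ s t h
  · have := S.other_mem y hy r v S.root_edge
    rw [S.root, dot_sub_half] at this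
    simp only [sub_zero, dot_zero_right, dot_comm] at this ⊢
    linarith
  · intro s t u _ htu ih
    have := S.other_mem y hy t u htu
    rw [dot_sub_half] at this
    simp only [dot, sub_re, sub_im] at this ih ⊢
    linarith

lemma near (S : BranchSetting x R r v Y N) {y : ℂ} (hy : y ∈ Y) {s t : W} (h : R s t) :
    2 * dot y (x t) ≤ dot y y :=
  S.near_zero _ (fun n hn => (S.node_mem n hn s t h).le) y hy

/-- The direction of another edge does not lie between those of two consecutive edges. -/
lemma not_between (S : BranchSetting x R r v Y N) {n : ℂ × ℂ} (hn : n ∈ N) {s t u : W}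
    (hst : R s t) (htu : R t u) (μ ν : ℝ) (hμ : 0 ≤ μ) (hν : 0 ≤ ν) :
    n.2 ≠ μ * (x t - x s) + ν * (x u - x t) := by
  intro e
  have h1 := S.base_mem n hn s t hst
  have h2 := S.base_mem n hn t u htu
  have h3 := S.node_mem n hn t u htu
  have h4 := (S.turn s t u hst htu).1
  rw [e, dot_add_left, dot_smul_left, dot_smul_left] at h3
  have h5 : 0 ≤ dot (x u - x t) (x u - x t) := dot_self_nonneg _
  have e1 : dot (x t - x s) (n.1 - (x s + x t) / 2)
      = dot (x t - x s) (n.1 - x t) + dot (x t - x s) (x t - x s) / 2 := by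
    rw [dot_sub_half]; simp only [dot_sub_right]; ring
  have e2 : dot (x u - x t) (n.1 - (x t + x u) / 2)
      = dot (x u - x t) (n.1 - x t) - dot (x u - x t) (x u - x t) / 2 := by
    rw [dot_sub_half]; simp only [dot_sub_right]; ring
  have e3 : dot (x t - x s) (x u - n.1)
      = dot (x t - x s) (x u - x t) - dot (x t - x s) (n.1 - x t) := by
    simp only [dot_sub_right]; ring
  have e4 : dot (x u - x t) (x u - n.1)
      = dot (x u - x t) (x u - x t) - dot (x u - x t) (n.1 - x t) := by
    simp only [dot_sub_right]; ring
  rw [e1] at h1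
  rw [e2] at h2
  rw [e3, e4] at h3
  nlinarith [mul_nonneg hμ h5, mul_nonneg hν h5]

lemma root_ne (S : BranchSetting x R r v Y N) : 0 < dot (x v) (x v) := by
  have := S.root_mem r v S.root_edge
  rw [S.root, dot_sub_half] at this
  simp only [sub_zero, dot_zero_right] at this
  linarith

lemma not_parallel (S : BranchSetting x R r v Y N) {n : ℂ × ℂ} (hn : n ∈ N) {κ : ℝ}
    (hκ : 0 ≤ κ) : n.2 ≠ κ * x v := by
  intro e
  have h1 := S.base_mem n hn r v S.root_edge
  have h2 := S.node_mem n hn r v S.root_edge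
  rw [S.root, dot_sub_half] at h1
  rw [e, dot_smul_left, dot_sub_right] at h2
  simp only [sub_zero, dot_zero_right] at h1
  nlinarith [S.root_ne]

/-- If the intersection of the half-planes of the other branches is bounded, then it has a corner
`q` such that the directions of all edges of the branch are in the open cone spanned by the normal
vectors of the two sides of the corner. -/
lemma exists_corner (S : BranchSetting x R r v Y N) {M : ℝ}
    (hM : ∀ z, (∀ n ∈ N, dot n.2 (z - n.1) ≤ 0) → ‖z‖ ≤ M) :
    ∃ q, (∀ n ∈ N, dot n.2 (q - n.1) ≤ 0) ∧ ∃ n₁ ∈ N, ∃ n₂ ∈ N,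
      dot n₁.2 (q - n₁.1) = 0 ∧ dot n₂.2 (q - n₂.1) = 0 ∧ 0 < crs n₁.2 n₂.2 ∧
      ∀ s t, R s t → 0 < crs n₁.2 (x t - x s) ∧ 0 < crs (x t - x s) n₂.2 := by
  set C : Set ℂ := {z | ∀ n ∈ N, dot n.2 (z - n.1) ≤ 0} with hC
  have hclosed : IsClosed C := by
    have : C = ⋂ n ∈ N, {z | dot n.2 (z - n.1) ≤ 0} := by ext; simp [hC]
    rw [this]
    refine isClosed_biInter fun n _ => ?_
    exact isClosed_le ((continuous_dot _).comp (by fun_prop)) continuous_const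
  have hcpt : IsCompact C := by
    refine Metric.isCompact_of_isClosed_isBounded hclosed ?_
    exact (Metric.isBounded_closedBall (x := (0 : ℂ)) (r := M)).subset fun z hz => by
      simpa using hM z hz
  have h0 : (0 : ℂ) ∈ C := fun n hn => by
    rw [dot_sub_right, dot_zero_right]; linarith [S.zero_mem n hn]
  obtain ⟨q, hq, hmax⟩ := hcpt.exists_isMaxOn ⟨0, h0⟩ (continuous_dot (x v)).continuousOn
  have hmax : ∀ z ∈ C, dot (x v) z ≤ dot (x v) q := fun z hz => hmax hz
  have ha := S.root_ne
  have haq : 0 < dot (x v) q :=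
    ha.trans_le (hmax _ fun n hn => (S.node_mem n hn r v S.root_edge).le)
  -- on each side of `x v` there is an active constraint, otherwise `q` could be moved
  have side : ∀ σ : ℝ, σ ^ 2 = 1 →
      ∃ n ∈ N, dot n.2 (q - n.1) = 0 ∧ 0 < σ * crs (x v) n.2 := by
    intro σ hσ
    by_contra hcon
    push Not at hcon
    have hK : ∀ᶠ K : ℝ in Filter.atTop, ∀ n ∈ N, 0 < -(σ * crs (x v) n.2) →
        dot n.2 (x v) - K * -(σ * crs (x v) n.2) ≤ 0 := by
      rw [Filter.eventually_all_finite S.finite_N]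
      intro n _
      filter_upwards [Filter.eventually_ge_atTop
        (dot n.2 (x v) / -(σ * crs (x v) n.2))] with K hK hpos
      rw [div_le_iff₀ hpos] at hK
      linarith
    obtain ⟨K, hK⟩ := hK.exists
    set w : ℂ := x v + ((K * σ : ℝ) : ℂ) * (I * x v) with hw
    have hfw : ∀ f, dot f w = dot f (x v) + K * (σ * crs (x v) f) := by
      intro f
      rw [hw, dot_add_right, dot_smul_right]
      simp only [dot, crs, mul_re, mul_im, I_re, I_im]; ring
    have hε : ∀ᶠ ε : ℝ in nhdsWithin 0 (Set.Ioi 0), ∀ n ∈ N,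
        dot n.2 (q + ε * w - n.1) ≤ 0 := by
      rw [Filter.eventually_all_finite S.finite_N]
      intro n hn
      have e : ∀ ε : ℝ, dot n.2 (q + ε * w - n.1) = dot n.2 (q - n.1) + ε * dot n.2 w := by
        intro ε
        rw [← dot_smul_right, ← dot_add_right]; congr 1; ring
      simp only [e]
      rcases le_or_gt (dot n.2 w) 0 with hle | hgt
      · filter_upwards [self_mem_nhdsWithin] with ε hε
        have := hq n hn
        nlinarith [Set.mem_Ioi.1 hε]
      · have hna : dot n.2 (q - n.1) < 0 := by
          refine lt_of_le_of_ne (hq n hn) fun h => ?_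
          have h1 := hcon n hn h
          rw [hfw] at hgt
          rcases eq_or_lt_of_le h1 with h2 | h2
          · -- `n.2` is parallel to `x v`
            have hc0 : crs (x v) n.2 = 0 := by
              rcases mul_eq_zero.1 h2 with h3 | h3
              · rw [h3] at hσ; norm_num at hσ
              · exact h3
            rw [h2, mul_zero, add_zero] at hgt
            refine S.not_parallel hn (κ := dot n.2 (x v) / dot (x v) (x v))
              (div_nonneg hgt.le ha.le) ?_
            have h4 : (dot (x v) (x v) : ℂ) * n.2 - dot n.2 (x v) * x v
                = crs (x v) n.2 * (I * x v) := by
              apply Complex.ext <;> simp [crs, dot] <;> ring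
            rw [hc0, ofReal_zero, zero_mul, sub_eq_zero] at h4
            have hne : (dot (x v) (x v) : ℂ) ≠ 0 := by exact_mod_cast ha.ne'
            push_cast
            field_simp
            linear_combination h4
          · have := hK n hn (by linarith)
            linarith
        have hlim : Filter.Tendsto (fun ε : ℝ => dot n.2 (q - n.1) + ε * dot n.2 w)
            (nhdsWithin 0 (Set.Ioi 0)) (nhds (dot n.2 (q - n.1) + 0 * dot n.2 w)) := by
          refine Filter.Tendsto.mono_left ?_ nhdsWithin_le_nhds
          exact (by fun_prop : Continuous fun ε : ℝ =>
            dot n.2 (q - n.1) + ε * dot n.2 w).tendsto 0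
        have := hlim.eventually_lt_const (u := 0) (by linarith)
        filter_upwards [this] with ε hε using hε.le
    obtain ⟨ε, hε1, hε2⟩ := (hε.and self_mem_nhdsWithin).exists
    have hm := hmax _ (show q + ε * w ∈ C from hε1)
    rw [dot_add_right, dot_smul_right, hfw] at hm
    have : crs (x v) (x v) = 0 := by simp only [crs]; ring
    rw [this] at hm
    have := mul_pos (Set.mem_Ioi.1 hε2) ha
    linarith
  obtain ⟨n₂, hn₂, a₂, c₂⟩ := side 1 (by norm_num)
  obtain ⟨n₁, hn₁, a₁, c₁⟩ := side (-1) (by norm_num)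
  rw [one_mul] at c₂
  have c₁' : 0 < crs n₁.2 (x v) := by
    have : crs n₁.2 (x v) = -1 * crs (x v) n₁.2 := by simp only [crs]; ring
    rw [this]; exact c₁
  have p₁ : 0 < dot n₁.2 q := by
    rw [dot_sub_right] at a₁; linarith [S.zero_mem n₁ hn₁]
  have p₂ : 0 < dot n₂.2 q := by
    rw [dot_sub_right] at a₂; linarith [S.zero_mem n₂ hn₂]
  have c₁₂ : 0 < crs n₁.2 n₂.2 := by
    have := dot_mul_crs q n₁.2 (x v) n₂.2
    nlinarith [mul_pos p₁ c₂, mul_pos p₂ c₁']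
  refine ⟨q, hq, n₁, hn₁, n₂, hn₂, a₁, a₂, c₁₂, ?_⟩
  refine S.induct (fun s t => 0 < crs n₁.2 (x t - x s) ∧ 0 < crs (x t - x s) n₂.2) ?_ ?_
  · rw [S.root, sub_zero]; exact ⟨c₁', c₂⟩
  · intro s t u hst htu ih
    exact cone_step ih.1 ih.2 c₁₂ (S.not_between hn₁ hst htu) (S.not_between hn₂ hst htu)
      (S.turn s t u hst htu).1 (S.turn s t u hst htu).2

lemma edge_other (S : BranchSetting x R r v Y N) {y : ℂ} (hy : y ∈ Y) {s t : W} (h : R s t) :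
    dot (x t - x s) y < dot (x t - x s) (x t) := by
  have := S.other_mem y hy s t h
  rw [dot_sub_half] at this
  have h2 := dot_self_nonneg (x t - x s)
  rw [dot_sub_right (x t - x s)] at h2
  linarith

lemma edge_zero (S : BranchSetting x R r v Y N) {s t : W} (h : R s t) :
    0 < dot (x t - x s) (x t) := by
  have := S.root_mem s t h
  rw [dot_sub_half, dot_zero_right] at this
  have h2 := dot_self_nonneg (x t - x s)
  rw [dot_sub_right (x t - x s)] at h2
  linarith

end BranchSetting

lemma crs_trans_nonneg {σ : ℝ} {q u v w : ℂ} (hu : 0 < dot u q) (hv : 0 < dot v q)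
    (hw : 0 < dot w q) (h₁ : 0 ≤ σ * crs u v) (h₂ : 0 ≤ σ * crs v w) : 0 ≤ σ * crs u w := by
  have := dot_mul_crs q u v w
  have e : dot v q * (σ * crs u w) = dot u q * (σ * crs v w) + dot w q * (σ * crs u v) := by
    linear_combination σ * this
  by_contra hcon
  nlinarith [mul_nonneg hu.le h₂, mul_nonneg hw.le h₁]

lemma crs_trans_pos {σ : ℝ} {q u v w : ℂ} (hu : 0 < dot u q) (hv : 0 < dot v q)
    (hw : 0 < dot w q) (h₁ : 0 < σ * crs u v) (h₂ : 0 ≤ σ * crs v w) : 0 < σ * crs u w := by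
  have := dot_mul_crs q u v w
  have e : dot v q * (σ * crs u w) = dot u q * (σ * crs v w) + dot w q * (σ * crs u v) := by
    linear_combination σ * this
  by_contra hcon
  nlinarith [mul_nonneg hu.le h₂, mul_pos hw h₁]

/-- If `t` lies in the angle between `q` and `y`, then its angle with `y` is at most that of
`q`. -/
lemma dot_mul_norm_le {σ : ℝ} (hσ : σ ≠ 0) {q t y : ℂ} (ht : 0 < dot t q) (hy : 0 < dot y q)
    (h₁ : 0 ≤ σ * crs q t) (h₂ : 0 ≤ σ * crs t y) : dot y q * ‖t‖ ≤ dot y t * ‖q‖ := by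
  have hq0 : q ≠ 0 := by rintro rfl; simp [dot] at ht
  have hq : 0 < dot q q := dot_self_pos hq0
  have hqy := crs_trans_nonneg hq ht hy h₁ h₂
  rcases eq_or_lt_of_le hqy with h0 | h0
  · have e : dot t q * (σ * crs q y) = dot q q * (σ * crs t y) + dot y q * (σ * crs q t) := by
      linear_combination σ * dot_mul_crs q q t y
    rw [← h0, mul_zero] at e
    have hqt : σ * crs q t = 0 := by nlinarith [mul_nonneg hq.le h₂, mul_nonneg hy.le h₁]
    have hqt : crs q t = 0 := (mul_eq_zero.1 hqt).resolve_left hσ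
    have e1 : dot q q * dot y t = dot t q * dot y q := by
      have : dot q q * dot y t - dot t q * dot y q = crs q t * crs q y := by
        simp only [dot, crs]; ring
      rw [hqt, zero_mul] at this
      linarith
    have e2 : ‖q‖ * ‖t‖ = dot t q := by
      have : dot q q * dot t t = dot t q ^ 2 + crs q t ^ 2 := by simp only [dot, crs]; ring
      rw [hqt, dot_self_eq_norm_sq, dot_self_eq_norm_sq] at this
      have h3 : (‖q‖ * ‖t‖) ^ 2 = dot t q ^ 2 := by rw [mul_pow]; linarith
      exact (sq_eq_sq₀ (by positivity) ht.le).1 h3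
    rw [← e2, dot_self_eq_norm_sq] at e1
    have hqn : 0 < ‖q‖ := norm_pos_iff.2 hq0
    have : ‖q‖ * (dot y q * ‖t‖) = ‖q‖ * (dot y t * ‖q‖) := by linear_combination -e1
    exact (mul_left_cancel₀ hqn.ne' this).le
  · have e : ((σ * crs q y : ℝ) : ℂ) * t
        = ((σ * crs t y : ℝ) : ℂ) * q + ((σ * crs q t : ℝ) : ℂ) * y := by
      push_cast
      linear_combination (σ : ℂ) * crs_smul_identity q t y
    have hn : (σ * crs q y) * ‖t‖ ≤ (σ * crs t y) * ‖q‖ + (σ * crs q t) * ‖y‖ := by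
      have := norm_add_le (((σ * crs t y : ℝ) : ℂ) * q) (((σ * crs q t : ℝ) : ℂ) * y)
      rw [← e, norm_mul, norm_mul, norm_mul, norm_real, norm_real, norm_real,
        Real.norm_of_nonneg hqy, Real.norm_of_nonneg h₁, Real.norm_of_nonneg h₂] at this
      exact this
    have hd : (σ * crs q y) * dot y t = (σ * crs t y) * dot y q + (σ * crs q t) * dot y y := by
      have := congrArg (dot y) e
      rwa [dot_smul_right, dot_add_right, dot_smul_right, dot_smul_right] at this
    rw [dot_self_eq_norm_sq] at hd
    have hcs := dot_le_norm_mul_norm y q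
    refine le_of_mul_le_mul_left ?_ h0
    calc σ * crs q y * (dot y q * ‖t‖) = dot y q * (σ * crs q y * ‖t‖) := by ring
      _ ≤ dot y q * ((σ * crs t y) * ‖q‖ + (σ * crs q t) * ‖y‖) := by gcongr
      _ = (σ * crs t y) * dot y q * ‖q‖ + (σ * crs q t) * ‖y‖ * dot y q := by ring
      _ ≤ (σ * crs t y) * dot y q * ‖q‖ + (σ * crs q t) * ‖y‖ * (‖y‖ * ‖q‖) := by gcongr
      _ = ((σ * crs t y) * dot y q + (σ * crs q t) * ‖y‖ ^ 2) * ‖q‖ := by ring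
      _ = σ * crs q y * (dot y t * ‖q‖) := by rw [← hd]; ring

/-- Let `q` be on the boundary of the half-plane `{z | f · z < k}` and not closer to `0` than to
`y`. A point `t` in the half-plane and closer to `0` than to `y` cannot have its direction both
between `q` and `y` and between `q` and `f`: turning from `q` to `t` enlarges the scope of the disk
around `y` and diminishes that of the half-plane. -/
lemma not_mem_both_angles {σ : ℝ} (hσ : σ ≠ 0) {q t y f : ℂ} {k : ℝ} (ht : 0 < dot t q)
    (h₁ : 0 ≤ σ * crs q t) (hy : 0 ≤ σ * crs t y) (hf : 0 ≤ σ * crs t f)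
    (hk : 0 < k) (hfq : dot f q = k) (hft : dot f t < k)
    (hyq : dot q q ≤ 2 * dot y q) (hyt : 2 * dot y t < dot t t) : False := by
  have hq0 : q ≠ 0 := by rintro rfl; simp [dot] at ht
  have ht0 : t ≠ 0 := by rintro rfl; simp [dot] at ht
  have hq : 0 < dot q q := dot_self_pos hq0
  have a := dot_mul_norm_le hσ ht (by linarith : 0 < dot y q) h₁ hy
  have b := dot_mul_norm_le hσ ht (by linarith : 0 < dot f q) h₁ hf
  have hqn : 0 < ‖q‖ := norm_pos_iff.2 hq0
  have htn : 0 < ‖t‖ := norm_pos_iff.2 ht0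
  rw [dot_self_eq_norm_sq] at hyq hyt
  rw [hfq] at b
  have a' : ‖q‖ ^ 2 / 2 * ‖t‖ ≤ dot y t * ‖q‖ :=
    le_trans (mul_le_mul_of_nonneg_right (by linarith) htn.le) a
  have c : ‖q‖ ^ 2 / 2 * ‖t‖ * (k * ‖t‖) ≤ dot y t * ‖q‖ * (dot f t * ‖q‖) :=
    mul_le_mul a' b (by positivity) (le_trans (by positivity) a')
  have d : dot y t * ‖q‖ * (dot f t * ‖q‖) < ‖t‖ ^ 2 / 2 * ‖q‖ * (k * ‖q‖) := by
    have p1 : 0 < dot f t * ‖q‖ := lt_of_lt_of_le (by positivity) b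
    refine mul_lt_mul'' ?_ ?_ (le_trans (by positivity) a') p1.le
    · exact mul_lt_mul_of_pos_right (by linarith) hqn
    · exact mul_lt_mul_of_pos_right hft hqn
  have e : ‖q‖ ^ 2 / 2 * ‖t‖ * (k * ‖t‖) = ‖t‖ ^ 2 / 2 * ‖q‖ * (k * ‖q‖) := by ring
  linarith

namespace BranchSetting

variable {W : Type*} {x : W → ℂ} {R : W → W → Prop} {r v : W} {Y : Set ℂ} {N : Set (ℂ × ℂ)}

lemma dot_pos_of_edges (S : BranchSetting x R r v Y N) {q : ℂ}
    (hpos : ∀ s t, R s t → 0 < dot (x t - x s) q) {s t : W} (h : R s t) : 0 < dot (x t) q := by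
  refine S.induct (fun _ t => 0 < dot (x t) q) ?_ ?_ s t h
  · have := hpos r v S.root_edge
    rwa [S.root, sub_zero] at this
  · intro s t u _ htu ih
    have := hpos t u htu
    rw [dot_sub_left] at this
    linarith

/-- Let `q` be a corner as in `exists_corner` that is not closer to the root than to a node `y` of
another branch. Then the branch lies on the side of the line through the root and `q` opposite
to `y`. The sign `σ` covers both orientations. -/
lemma opposite_side (S : BranchSetting x R r v Y N) {σ : ℝ} (hσ : σ ≠ 0) {q y : ℂ} {n : ℂ × ℂ}
    (hq : ∀ n ∈ N, dot n.2 (q - n.1) ≤ 0) (hn : n ∈ N) (hnq : dot n.2 (q - n.1) = 0)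
    (hf : ∀ s t, R s t → 0 < σ * crs (x t - x s) n.2)
    (hpos : ∀ s t, R s t → 0 < dot (x t - x s) q)
    (hvq : dot (x v) (x v) ≤ dot (x v) q)
    (hy : y ∈ Y) (hyq : dot q q ≤ 2 * dot y q) (hyσ : 0 ≤ σ * crs q y) :
    ∀ s t, R s t → σ * crs q (x t) < 0 := by
  have hnq' : dot n.2 q = dot n.2 n.1 := by rw [dot_sub_right] at hnq; linarith
  have hk := S.zero_mem n hn
  have hq0 : q ≠ 0 := by
    rintro rfl
    have := hpos r v S.root_edge
    simp [dot] at this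
  have hqq : 0 < dot q q := dot_self_pos hq0
  have hyq' : 0 < dot y q := by linarith
  have hfq : 0 < dot n.2 q := by linarith
  have contra : ∀ s t, R s t → 0 ≤ σ * crs q (x t) → 0 ≤ σ * crs (x t) y →
      0 ≤ σ * crs (x t) n.2 → False := by
    intro s t h h1 h2 h3
    have h4 := S.node_mem n hn s t h
    rw [dot_sub_right] at h4
    exact not_mem_both_angles hσ (S.dot_pos_of_edges hpos h) h1 h2 h3 hk hnq' (by linarith) hyq
      (S.far hy h)
  have rev : ∀ a b, σ * crs a b = -(σ * crs b a) := by
    intro a b; simp only [crs]; ring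
  refine S.induct (fun _ t => σ * crs q (x t) < 0) ?_ ?_
  · by_contra hcon
    have hcon := not_lt.1 hcon
    have hfv := hf r v S.root_edge
    rw [S.root, sub_zero] at hfv
    refine contra r v S.root_edge hcon ?_ hfv.le
    -- otherwise `y` is between `q` and `x v`, which is impossible for reasons of length
    by_contra hyv
    have hvy : 0 < σ * crs y (x v) := by rw [rev]; linarith
    have hv0 := S.root_ne
    have hvq0 : 0 < dot (x v) q := by linarith
    have hqv : 0 < σ * crs q (x v) := by
      have := crs_trans_pos (σ := -σ) (q := q) (u := x v) (v := y) (w := q) hvq0 hyq' hqq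
        (by rw [neg_mul, rev]; linarith) (by rw [neg_mul, rev]; linarith)
      rw [neg_mul, rev] at this; linarith
    set D := σ * crs q (x v) with hD
    set μ := σ * crs y (x v) with hμ
    set ν := σ * crs q y with hν
    have e : ∀ z, D * dot z y = μ * dot z q + ν * dot z (x v) := by
      intro z; rw [hD, hμ, hν]; simp only [dot, crs]; ring
    have e1 := e y
    have e2 := e (x v)
    have n1 := S.near_zero q hq y hy
    have n2 := S.near hy S.root_edge
    have n3 := S.far hy S.root_edge
    have hyy : 0 < dot y y := by linarith
    -- `y = (μ q + ν (x v)) / D` with `μ + ν ≥ 2 D`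
    have s1 : 2 * D ≤ μ + ν := by
      have : 2 * D * dot y y ≤ (μ + ν) * dot y y := by nlinarith
      exact le_of_mul_le_mul_right this hyy
    have s2 : (μ + ν) * dot (x v) (x v) ≤ D * dot (x v) y := by nlinarith
    have s3 : D * dot (x v) y < D * (dot (x v) (x v) / 2) := by
      refine mul_lt_mul_of_pos_left ?_ hqv
      rw [dot_comm]; linarith
    nlinarith [mul_pos hqv hv0]
  · intro s t u hst htu ih
    by_contra hcon
    have hcon := not_lt.1 hcon
    have hs := S.dot_pos_of_edges hpos hst
    have ht := S.dot_pos_of_edges hpos htu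
    have hqs : 0 < σ * crs (x t) q := by rw [rev]; linarith
    have htu' : 0 < σ * crs (x t) (x u) := crs_trans_pos hs hqq ht hqs hcon
    have hue : 0 < σ * crs (x u) (x u - x t) := by
      have : crs (x u) (x u - x t) = crs (x t) (x u) := by simp [crs]; ring
      rwa [this]
    refine contra t u htu hcon ?_ (crs_trans_pos ht (hpos t u htu) hfq hue (hf t u htu).le).le
    by_contra hyu
    -- otherwise the direction of `y` is between those of the adjacent nodes `t` and `u`
    have hyu : 0 < σ * crs y (x u) := by rw [rev]; linarith
    have hty : 0 < σ * crs (x t) y := crs_trans_pos hs hqq hyq' hqs hyσ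
    have htr : t ≠ r := by
      rintro rfl
      rw [S.root] at hs; simp [dot] at hs
    have g1 := S.near_parent t u htu htr
    set D := σ * crs (x t) (x u) with hD
    set μ := σ * crs y (x u) with hμ
    set ν := σ * crs (x t) y with hν
    have e : ∀ z, D * dot z y = μ * dot z (x t) + ν * dot z (x u) := by
      intro z; rw [hD, hμ, hν]; simp only [dot, crs]; ring
    have e1 := e y
    have e2 := e (x t)
    have n1 := S.near hy hst
    have n2 := S.near hy htu
    have n3 := S.far hy hst
    have htt : 0 < dot (x t) (x t) := dot_self_pos fun h => by rw [h] at hs; simp [dot] at hs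
    have hyy : 0 < dot y y := dot_self_pos fun h => by rw [h] at hyq'; simp [dot] at hyq'
    have s1 : 2 * D ≤ μ + ν := by
      have : 2 * D * dot y y ≤ (μ + ν) * dot y y := by nlinarith
      exact le_of_mul_le_mul_right this hyy
    have s2 : (2 * μ + ν) * dot (x t) (x t) ≤ 2 * D * dot (x t) y := by nlinarith
    have s3 : 2 * D * dot (x t) y < D * dot (x t) (x t) := by
      rw [dot_comm]; nlinarith
    have s4 : 2 * μ + ν < D := by
      refine lt_of_mul_lt_mul_right (lt_of_le_of_lt s2 s3) htt.le
    linarith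

end BranchSetting

/-! ### Replacing a branch by a point -/

namespace BranchSetting

variable {W : Type*} {x : W → ℂ} {R : W → W → Prop} {r v : W} {Y : Set ℂ} {N : Set (ℂ × ℂ)}

/-- `z` can replace the branch if only the edge directions `e` in `E` matter: `z` lies in the
half-planes of the other branches, whose nodes are closer to the root than to `z`, and from `z` all
of them are seen in directions that form obtuse angles with the members of `E`. -/
structure IsSubstitute (Y : Set ℂ) (N : Set (ℂ × ℂ)) (E : Set ℂ) (z : ℂ) : Prop where
  mem : ∀ n ∈ N, dot n.2 (z - n.1) < 0
  far : ∀ y ∈ Y, 2 * dot y z < dot z z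
  other : ∀ e ∈ E, ∀ y ∈ Y, dot e y < dot e z
  zero : ∀ e ∈ E, 0 < dot e z

/-- If the branch lies on one side of the line through the root and the corner `q`, then the end
node of an edge can be moved away from the root to become a substitute with respect to that edge
and any other edge that ends closer to the line. -/
lemma exists_substitute_of_side (S : BranchSetting x R r v Y N) {σ : ℝ} {q : ℂ}
    (hq : ∀ n ∈ N, dot n.2 (q - n.1) ≤ 0)
    (hqY : ∀ s t, R s t → ∀ y ∈ Y, dot (x t - x s) y < dot (x t - x s) q)
    (hpos : ∀ s t, R s t → 0 < dot (x t - x s) q)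
    (hside : ∀ s t, R s t → σ * crs q (x t) < 0)
    {s₁ t₁ s₂ t₂ : W} (h₁ : R s₁ t₁) (h₂ : R s₂ t₂) (h : 0 ≤ σ * crs (x t₂) (x t₁)) :
    ∃ z, IsSubstitute Y N {x t₁ - x s₁, x t₂ - x s₂} z := by
  have p₁ := S.dot_pos_of_edges hpos h₁
  have p₂ := S.dot_pos_of_edges hpos h₂
  have hq0 : q ≠ 0 := by rintro rfl; simp [dot] at p₁
  have hqq : 0 < dot q q := dot_self_pos hq0
  have d₁ := hside _ _ h₁
  set α := σ * crs (x t₂) (x t₁) with hα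
  set β := -(σ * crs q (x t₁)) with hβ
  have hβ0 : 0 < β := by rw [hβ]; linarith
  -- the point of the segment from `x t₂` to `q` in the direction of `x t₁`
  set θ := α / (α + β) with hθ
  have hθ0 : 0 ≤ θ := by positivity
  have hθ1 : θ < 1 := by rw [hθ, div_lt_one (by linarith)]; linarith
  set z := ((1 - θ : ℝ) : ℂ) * x t₂ + (θ : ℂ) * q with hz
  have dz : ∀ f, dot f z = (1 - θ) * dot f (x t₂) + θ * dot f q := by
    intro f; rw [hz, dot_add_right, dot_smul_right, dot_smul_right]
  have zq : 0 < dot q z := by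
    rw [dz, dot_comm q]
    nlinarith [mul_nonneg hθ0 hqq.le, mul_pos (by linarith : 0 < 1 - θ) p₂]
  set l := dot q z / dot (x t₁) q with hl
  have hl0 : 0 < l := div_pos zq p₁
  have hzl : z = (l : ℂ) * x t₁ := by
    have hc : σ * crs z (x t₁) = 0 := by
      have : σ * crs z (x t₁) = (1 - θ) * α - θ * β := by
        rw [hz, hα, hβ]; simp only [crs, add_re, add_im, re_ofReal_mul, im_ofReal_mul]; ring
      rw [this, hθ]
      field_simp
      ring
    have hσ : σ ≠ 0 := by rintro rfl; simp at d₁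
    have hc : crs z (x t₁) = 0 := (mul_eq_zero.1 hc).resolve_left hσ
    have e : (dot (x t₁) q : ℂ) * z = (dot q z : ℂ) * x t₁ := by
      have : (dot (x t₁) q : ℂ) * z - (dot q z : ℂ) * x t₁ = -(crs z (x t₁) : ℂ) * (I * q) := by
        apply Complex.ext <;> simp [crs, dot] <;> ring
      rw [hc] at this
      simpa [sub_eq_zero] using this
    have hne : (dot (x t₁) q : ℂ) ≠ 0 := by exact_mod_cast p₁.ne'
    rw [hl]
    push_cast
    field_simp
    linear_combination e
  have zmem : ∀ n ∈ N, dot n.2 (z - n.1) < 0 := by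
    intro n hn
    have a := S.node_mem n hn _ _ h₂
    have b := hq n hn
    rw [dot_sub_right] at a b ⊢
    rw [dz]
    nlinarith
  have z2 : ∀ y ∈ Y, dot (x t₂ - x s₂) y < dot (x t₂ - x s₂) z := by
    intro y hy
    have a := S.edge_other hy h₂
    have b := hqY _ _ h₂ y hy
    rw [dz]
    nlinarith
  have z2' : 0 < dot (x t₂ - x s₂) z := by
    have a := S.edge_zero h₂
    have b := hpos _ _ h₂
    rw [dz]
    nlinarith
  rcases le_total 1 l with h1 | h1
  · refine ⟨z, zmem, ?_, ?_, ?_⟩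
    · intro y hy
      have := S.far hy h₁
      have h3 : 0 < dot (x t₁) (x t₁) := dot_self_pos fun h => by rw [h] at p₁; simp [dot] at p₁
      rw [hzl, dot_smul_right, dot_smul_left, dot_smul_right]
      have : 2 * dot y (x t₁) < l * dot (x t₁) (x t₁) := by nlinarith
      nlinarith
    · rintro e (rfl | rfl) y hy
      · have a := S.edge_other hy h₁
        have b := S.edge_zero h₁
        rw [hzl, dot_smul_right]
        nlinarith
      · exact z2 y hy
    · rintro e (rfl | rfl)
      · rw [hzl, dot_smul_right]
        exact mul_pos hl0 (S.edge_zero h₁)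
      · exact z2'
  · rw [hzl] at z2 z2'
    rw [dot_smul_right] at z2'
    have p : 0 < dot (x t₂ - x s₂) (x t₁) := pos_of_mul_pos_right z2' hl0.le
    refine ⟨x t₁, fun n hn => S.node_mem n hn _ _ h₁, fun y hy => S.far hy h₁, ?_, ?_⟩
    · rintro e (rfl | rfl) y hy
      · exact S.edge_other hy h₁
      · have := z2 y hy
        rw [dot_smul_right] at this
        nlinarith
    · rintro e (rfl | rfl)
      · exact S.edge_zero h₁
      · exact p

/-- In the bounded case the branch has a substitute with respect to any two of its edges, and the
directions of all of its edges lie in an open half-plane. -/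
lemma exists_substitute (S : BranchSetting x R r v Y N) {M : ℝ}
    (hM : ∀ z, (∀ n ∈ N, dot n.2 (z - n.1) ≤ 0) → ‖z‖ ≤ M) :
    (∃ q, ∀ s t, R s t → 0 < dot (x t - x s) q) ∧
    ∀ s₁ t₁ s₂ t₂ : W, R s₁ t₁ → R s₂ t₂ →
      ∃ z, IsSubstitute Y N {x t₁ - x s₁, x t₂ - x s₂} z := by
  obtain ⟨q, hq, n₁, hn₁, n₂, hn₂, a₁, a₂, c, hc⟩ := S.exists_corner hM
  -- the corner maximizes all edge directions
  have hmax : ∀ s t, R s t → ∀ z, dot n₁.2 (z - n₁.1) < 0 → dot n₂.2 (z - n₂.1) < 0 →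
      dot (x t - x s) z < dot (x t - x s) q := by
    intro s t h z h₁ h₂
    obtain ⟨c₁, c₂⟩ := hc s t h
    have ez := dot_mul_crs z n₁.2 (x t - x s) n₂.2
    have eq := dot_mul_crs q n₁.2 (x t - x s) n₂.2
    rw [dot_sub_right] at h₁ h₂ a₁ a₂
    have i₁ : dot n₁.2 z < dot n₁.2 q := by linarith
    have i₂ : dot n₂.2 z < dot n₂.2 q := by linarith
    refine lt_of_mul_lt_mul_right ?_ c.le
    rw [ez, eq]
    nlinarith [mul_lt_mul_of_pos_right i₁ c₂, mul_lt_mul_of_pos_right i₂ c₁]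
  have zlt : ∀ n ∈ N, dot n.2 (0 - n.1) < 0 := by
    intro n hn
    rw [dot_sub_right, dot_zero_right]; linarith [S.zero_mem n hn]
  have hpos : ∀ s t, R s t → 0 < dot (x t - x s) q := by
    intro s t h
    have := hmax s t h 0 (zlt _ hn₁) (zlt _ hn₂)
    rwa [dot_zero_right] at this
  refine ⟨⟨q, hpos⟩, fun s₁ t₁ s₂ t₂ h₁ h₂ => ?_⟩
  have hqt : ∀ s t, R s t → dot (x t - x s) (x t) < dot (x t - x s) q := fun s t h =>
    hmax s t h _ (S.node_mem n₁ hn₁ s t h) (S.node_mem n₂ hn₂ s t h)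
  have hqY : ∀ s t, R s t → ∀ y ∈ Y, dot (x t - x s) y < dot (x t - x s) q := fun s t h y hy =>
    (S.edge_other hy h).trans (hqt s t h)
  have hvq : dot (x v) (x v) ≤ dot (x v) q := by
    have := (hqt r v S.root_edge).le
    rwa [S.root, sub_zero] at this
  by_cases hviol : ∃ y ∈ Y, dot q q ≤ 2 * dot y q
  · obtain ⟨y, hy, hyq⟩ := hviol
    have fin : ∀ σ : ℝ, (∀ s t, R s t → σ * crs q (x t) < 0) →
        ∃ z, IsSubstitute Y N {x t₁ - x s₁, x t₂ - x s₂} z := by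
      intro σ hside
      rcases le_total 0 (σ * crs (x t₂) (x t₁)) with h | h
      · exact S.exists_substitute_of_side hq hqY hpos hside h₁ h₂ h
      · rw [Set.pair_comm]
        refine S.exists_substitute_of_side hq hqY hpos hside h₂ h₁ ?_
        have : crs (x t₁) (x t₂) = -crs (x t₂) (x t₁) := by simp only [crs]; ring
        rw [this]; linarith
    rcases le_total 0 (crs q y) with h | h
    · refine fin 1 (S.opposite_side one_ne_zero hq hn₂ a₂ ?_ hpos hvq hy hyq (by linarith))
      intro s t hst
      rw [one_mul]; exact (hc s t hst).2
    · refine fin (-1) (S.opposite_side (by norm_num) hq hn₁ a₁ ?_ hpos hvq hy hyq (by linarith))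
      intro s t hst
      have : crs (x t - x s) n₁.2 = -crs n₁.2 (x t - x s) := by simp only [crs]; ring
      rw [this]; linarith [(hc s t hst).1]
  · push Not at hviol
    have hev : ∀ᶠ ε : ℝ in nhdsWithin 0 (Set.Ioi 0), ε < 1 ∧ ∀ y ∈ Y,
        (2 * dot y q < (1 - ε) * dot q q ∧ dot (x t₁ - x s₁) y < (1 - ε) * dot (x t₁ - x s₁) q) ∧
        dot (x t₂ - x s₂) y < (1 - ε) * dot (x t₂ - x s₂) q := by
      have lim : ∀ c d : ℝ, c < d → ∀ᶠ ε : ℝ in nhdsWithin 0 (Set.Ioi 0), c < (1 - ε) * d := by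
        intro c d hcd
        refine Filter.Eventually.filter_mono nhdsWithin_le_nhds ?_
        exact (by fun_prop : Continuous fun ε : ℝ => (1 - ε) * d).tendsto 0
          |>.eventually_const_lt (by simpa using hcd)
      refine Filter.Eventually.and ?_ ?_
      · exact Filter.Eventually.filter_mono nhdsWithin_le_nhds (gt_mem_nhds one_pos)
      · rw [Filter.eventually_all_finite S.finite_Y]
        intro y hy
        exact ((lim _ _ (hviol y hy)).and (lim _ _ (hqY _ _ h₁ y hy))).and
          (lim _ _ (hqY _ _ h₂ y hy))
    obtain ⟨ε, ⟨hε1, hε⟩, hε0⟩ := (hev.and self_mem_nhdsWithin).exists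
    have hε0 : 0 < ε := hε0
    refine ⟨((1 - ε : ℝ) : ℂ) * q, ?_, ?_, ?_, ?_⟩
    · intro n hn
      have a := hq n hn
      have b := S.zero_mem n hn
      rw [dot_sub_right] at a ⊢
      rw [dot_smul_right]
      nlinarith
    · intro y hy
      rw [dot_smul_right, dot_smul_left, dot_smul_right]
      nlinarith [(hε y hy).1.1]
    · rintro e (rfl | rfl) y hy
      · rw [dot_smul_right]; exact (hε y hy).1.2
      · rw [dot_smul_right]; exact (hε y hy).2
    · rintro e (rfl | rfl)
      · rw [dot_smul_right]; exact mul_pos (by linarith) (hpos _ _ h₁)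
      · rw [dot_smul_right]; exact mul_pos (by linarith) (hpos _ _ h₂)

/-- In the unbounded case a point far away from the root is a substitute; it sees all nodes of the
other branches within an arbitrarily small angle. -/
lemma exists_substitute_of_unbounded (S : BranchSetting x R r v Y N)
    (hM : ∀ M : ℝ, ∃ z, (∀ n ∈ N, dot n.2 (z - n.1) ≤ 0) ∧ M < ‖z‖) {φ : ℝ} (hφ : 0 < φ)
    (hφπ : φ ≤ Real.pi) :
    ∃ z e₁ e₂, IsSubstitute Y N {e₁, e₂} z ∧ ∀ w w', dot e₁ w < 0 → dot e₂ w < 0 →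
      dot e₁ w' < 0 → dot e₂ w' < 0 → InnerProductGeometry.angle w w' < φ := by
  have hπ := Real.pi_pos
  obtain ⟨B, hB⟩ := (S.finite_Y.image norm).bddAbove
  have hB' : ∀ y ∈ Y, ‖y‖ ≤ B := fun y hy => hB ⟨y, hy, rfl⟩
  set κ := Real.sin (φ / 4) with hκ
  have hκ0 : 0 < κ := Real.sin_pos_of_pos_of_lt_pi (by linarith) (by linarith)
  obtain ⟨z', hz', hlt⟩ := hM (max 0 (2 * max (2 * B) (B / κ)))
  -- half of `z'` is in the interiors of the half-planes
  set z := ((1 / 2 : ℝ) : ℂ) * z' with hz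
  have hzn : max (2 * B) (B / κ) < ‖z‖ := by
    have : ‖z‖ = 1 / 2 * ‖z'‖ := by rw [hz, norm_mul, norm_real, Real.norm_of_nonneg (by norm_num)]
    rw [this]
    linarith [le_max_right 0 (2 * max (2 * B) (B / κ))]
  have hz0 : z ≠ 0 := by
    have h1 : 0 < ‖z'‖ := (le_max_left _ _).trans_lt hlt
    rw [hz]
    exact mul_ne_zero (by norm_num) (norm_pos_iff.1 h1)
  have hzp : 0 < ‖z‖ := norm_pos_iff.2 hz0
  set A := Real.pi / 2 + φ / 4 with hA
  -- the directions perpendicular to the sides of a cone with apex `z` and axis through the root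
  have t₁ : HasTurn (-z) (exp ((-A : ℝ) * I) * -z) (-A) := ⟨1, one_pos, by simp⟩
  have t₂ : HasTurn (-z) (exp ((A : ℝ) * I) * -z) A := ⟨1, one_pos, by simp⟩
  have key : ∀ s : ℝ, (s = A ∨ s = -A) → ∀ y : ℂ, (‖y‖ ≤ B ∨ y = 0) →
      dot (exp (s * I) * -z) y < dot (exp (s * I) * -z) z := by
    intro s hs y hy
    have hc : Real.cos s = -κ := by
      rcases hs with rfl | rfl
      · rw [hA, hκ, add_comm, Real.cos_add_pi_div_two]
      · rw [hA, hκ, Real.cos_neg, add_comm, Real.cos_add_pi_div_two]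
    have e : dot (exp (s * I) * -z) z = κ * ‖z‖ ^ 2 := by
      rw [← dot_self_eq_norm_sq, ← neg_neg κ, ← hc]
      simp [dot, Complex.exp_ofReal_mul_I_re, Complex.exp_ofReal_mul_I_im]; ring
    rw [e]
    have h1 : dot (exp (s * I) * -z) y ≤ ‖z‖ * ‖y‖ := by
      refine (dot_le_norm_mul_norm _ _).trans ?_
      rw [norm_mul, norm_exp_ofReal_mul_I, one_mul, norm_neg]
    have h2 : ‖y‖ < κ * ‖z‖ := by
      rcases hy with hy | rfl
      · have := (le_max_right (2 * B) (B / κ)).trans_lt hzn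
        rw [div_lt_iff₀ hκ0] at this
        linarith
      · rw [norm_zero]; positivity
    nlinarith
  refine ⟨z, exp ((-A : ℝ) * I) * -z, exp ((A : ℝ) * I) * -z, ⟨?_, ?_, ?_, ?_⟩, ?_⟩
  rotate_left 4
  · intro w w' a b c d
    have := angle_lt_of_dot_neg (neg_ne_zero.2 hz0) t₁ t₂ (by rw [hA]; linarith)
      (by rw [hA]; linarith) a b c d
    refine this.trans ?_
    rw [hA]; linarith
  · intro n hn
    have a := hz' n hn
    have b := S.zero_mem n hn
    rw [dot_sub_right] at a ⊢
    rw [hz, dot_smul_right]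
    linarith
  · intro y hy
    have h1 := dot_le_norm_mul_norm y z
    rw [dot_self_eq_norm_sq]
    have h2 := hB' y hy
    have h3 := (le_max_left (2 * B) (B / κ)).trans_lt hzn
    nlinarith
  · rintro e (rfl | rfl) y hy
    · exact key (-A) (Or.inr rfl) y (Or.inl (hB' y hy))
    · exact key A (Or.inl rfl) y (Or.inl (hB' y hy))
  · rintro e (rfl | rfl)
    · have := key (-A) (Or.inr rfl) 0 (Or.inr rfl)
      rwa [dot_zero_right] at this
    · have := key A (Or.inl rfl) 0 (Or.inr rfl)
      rwa [dot_zero_right] at this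

end BranchSetting

/-! ### Shrinking all branches -/

namespace RootedDrawing

variable {W : Type*} {x : W → ℂ} {R : W → W → Prop} {r v : W}

lemma eq_root_or_exists_parent (T : RootedDrawing x R r v) {s t : W} (h : R s t) :
    s = r ∨ ∃ p, R p s :=
  T.induct (fun s _ => s = r ∨ ∃ p, R p s) (Or.inl rfl) (fun s _ _ h _ _ => Or.inr ⟨s, h⟩) s t h

lemma near (T : RootedDrawing x R r v) {z : ℂ}
    (hz : ∀ s t, R s t → dot (x t - x s) (z - (x s + x t) / 2) ≤ 0) {s t : W} (h : R s t) :
    2 * dot (x t) z ≤ dot (x t) (x t) := by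
  refine T.induct (fun _ t => 2 * dot (x t) z ≤ dot (x t) (x t)) ?_ ?_ s t h
  · have := hz r v T.root_edge
    rw [T.root, dot_sub_half] at this
    simp only [sub_zero, dot_zero_right] at this
    linarith
  · intro s t u _ htu ih
    have := hz t u htu
    rw [dot_sub_half] at this
    simp only [dot, sub_re, sub_im] at this ih ⊢
    linarith

end RootedDrawing

/-- The nodes, other than the root, of a rooted tree with edges `R` in the drawing `x`. -/
def nodes {W : Type*} (x : W → ℂ) (R : W → W → Prop) : Set ℂ := {y | ∃ s t, R s t ∧ x t = y}

/-- The half-planes that an edge directed away from the root assigns to the root, encoded by the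
midpoint and the direction of the edge. -/
def halfPlanes {W : Type*} (x : W → ℂ) (R : W → W → Prop) : Set (ℂ × ℂ) :=
  {n | ∃ s t, R s t ∧ ((x s + x t) / 2, x t - x s) = n}

/-- A family of branches at the origin, each given by its nodes and its half-planes (encoded as in
`BranchSetting`), such that the half-planes of each branch contain the other branches. Besides drawn
trees, this covers branches that have been shrunk to a single point; see `shrunk`. -/
structure IsSystem {ι : Type*} (P : ι → Set ℂ) (N : ι → Set (ℂ × ℂ)) : Prop where
  finite_nodes : ∀ i, (P i).Finite
  finite_halfPlanes : ∀ i, (N i).Finite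
  zero_mem : ∀ i, ∀ n ∈ N i, 0 < dot n.2 n.1
  compat : ∀ i j, i ≠ j → ∀ n ∈ N i, ∀ y ∈ P j, dot n.2 (y - n.1) < 0
  /-- A point in the half-planes of a branch is at least as close to the origin as to its nodes. -/
  near : ∀ i z, (∀ n ∈ N i, dot n.2 (z - n.1) ≤ 0) → ∀ y ∈ P i, 2 * dot y z ≤ dot y y
  /-- The base points of the half-planes are in the convex hull of the branch. -/
  base : ∀ i, ∀ n ∈ N i, ∀ (e : ℂ) (k : ℝ), 0 < k → (∀ y ∈ P i, dot e y < k) → dot e n.1 < k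

/-- The half-planes of a branch that has been shrunk to the point `q`: that of the edge from the
origin to `q`, and those of two infinitesimally short edges at `q` with directions `e₁`, `e₂`. -/
def shrunk (q e₁ e₂ : ℂ) : Set (ℂ × ℂ) := {(q / 2, q), (q, e₁), (q, e₂)}

/-- Any two directions that form obtuse angles with `e₁` and `e₂` form an angle less than `φ`. -/
def ConeAngleLT (φ : ℝ) (e₁ e₂ : ℂ) : Prop :=
  ∀ w w', dot e₁ w < 0 → dot e₂ w < 0 → dot e₁ w' < 0 → dot e₂ w' < 0 →
    InnerProductGeometry.angle w w' < φ

lemma halfPlanes_finite {W : Type*} [Finite W] (x : W → ℂ) (R : W → W → Prop) :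
    (halfPlanes x R).Finite :=
  (Set.finite_range fun p : W × W => ((x p.1 + x p.2) / 2, x p.2 - x p.1)).subset
    (by rintro _ ⟨s, t, -, rfl⟩; exact ⟨(s, t), rfl⟩)

lemma nodes_finite {W : Type*} [Finite W] (x : W → ℂ) (R : W → W → Prop) :
    (nodes x R).Finite :=
  (Set.finite_range x).subset (by rintro _ ⟨s, t, -, rfl⟩; exact ⟨t, rfl⟩)

lemma RootedDrawing.isSystem {ι : Type*} {W : ι → Type*} [∀ i, Finite (W i)] {x : ∀ i, W i → ℂ}
    {R : ∀ i, W i → W i → Prop} {r v : ∀ i, W i} (T : ∀ i, RootedDrawing (x i) (R i) (r i) (v i))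
    (h : ∀ i j, i ≠ j → ∀ n ∈ halfPlanes (x i) (R i), ∀ y ∈ nodes (x j) (R j),
      dot n.2 (y - n.1) < 0) :
    IsSystem (fun i => nodes (x i) (R i)) (fun i => halfPlanes (x i) (R i)) where
  finite_nodes i := nodes_finite _ _
  finite_halfPlanes i := halfPlanes_finite _ _
  zero_mem := by
    rintro i _ ⟨s, t, hst, rfl⟩
    have := (T i).root_mem s t hst
    rw [dot_sub_right, dot_zero_right] at this
    simpa using this
  compat := h
  near := by
    rintro i z hz _ ⟨s, t, hst, rfl⟩
    exact (T i).near (fun s t hst => hz _ ⟨s, t, hst, rfl⟩) hst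
  base := by
    rintro i _ ⟨s, t, hst, rfl⟩ e k hk hy
    have h1 := hy _ ⟨s, t, hst, rfl⟩
    have h2 : dot e (x i s) < k := by
      rcases (T i).eq_root_or_exists_parent hst with rfl | ⟨p, hp⟩
      · rw [(T i).root, dot_zero_right]; exact hk
      · exact hy _ ⟨p, s, hp, rfl⟩
    have h3 := dot_sub_half e (x i s) (x i t) 0
    rw [zero_sub, dot_neg_right, dot_zero_right] at h3
    show dot e ((x i s + x i t) / 2) < k
    linarith

/-- A drawn branch of a system can be shrunk to a point, provided that for any direction `q` that
forms acute angles with all of its edges, two of its edges bound a cone of angle less than `φ`. -/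
lemma IsSystem.exists_shrink {ι : Type*} [DecidableEq ι] [Finite ι] {P : ι → Set ℂ}
    {N : ι → Set (ℂ × ℂ)} (S : IsSystem P N) {i : ι} {W : Type*} {x : W → ℂ}
    {R : W → W → Prop} {r v : W} (T : RootedDrawing x R r v) (hP : P i = nodes x R)
    (hN : N i = halfPlanes x R) {φ : ℝ} (hφ : 0 < φ) (hφπ : φ ≤ Real.pi)
    (hang : ∀ q, (∀ s t, R s t → 0 < dot (x t - x s) q) →
      ∃ s₁ t₁ s₂ t₂, R s₁ t₁ ∧ R s₂ t₂ ∧ ConeAngleLT φ (x t₁ - x s₁) (x t₂ - x s₂)) :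
    ∃ q e₁ e₂, ConeAngleLT φ e₁ e₂ ∧
      IsSystem (Function.update P i {q}) (Function.update N i (shrunk q e₁ e₂)) := by
  have B : BranchSetting x R r v (⋃ j ∈ {j | j ≠ i}, P j) (⋃ j ∈ {j | j ≠ i}, N j) := by
    refine ⟨T, ?_, ?_, ?_, ?_, ?_, ?_, ?_⟩
    · exact Set.Finite.biUnion (Set.toFinite _) fun j _ => S.finite_nodes j
    · exact Set.Finite.biUnion (Set.toFinite _) fun j _ => S.finite_halfPlanes j
    · intro n hn
      simp only [Set.mem_iUnion] at hn
      obtain ⟨j, -, hn⟩ := hn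
      exact S.zero_mem j n hn
    · intro z hz y hy
      simp only [Set.mem_iUnion] at hy hz
      obtain ⟨j, hj, hy⟩ := hy
      exact S.near j z (fun n hn => hz n ⟨j, hj, hn⟩) y hy
    · intro n hn s t hst
      simp only [Set.mem_iUnion] at hn
      obtain ⟨j, hj, hn⟩ := hn
      exact S.compat j i hj n hn _ (hP ▸ ⟨s, t, hst, rfl⟩)
    · intro n hn s t hst
      simp only [Set.mem_iUnion] at hn
      obtain ⟨j, hj, hn⟩ := hn
      have hm : ((x s + x t) / 2, x t - x s) ∈ N i := hN ▸ ⟨s, t, hst, rfl⟩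
      have := S.base j n hn (x t - x s) (dot (x t - x s) ((x s + x t) / 2))
        (S.zero_mem i _ hm) (fun y hy => by
          have := S.compat i j (Ne.symm hj) _ hm y hy
          rw [dot_sub_right] at this
          linarith)
      rw [dot_sub_right]
      linarith
    · intro y hy s t hst
      simp only [Set.mem_iUnion] at hy
      obtain ⟨j, hj, hy⟩ := hy
      have hm : ((x s + x t) / 2, x t - x s) ∈ N i := hN ▸ ⟨s, t, hst, rfl⟩
      exact S.compat i j (Ne.symm hj) _ hm y hy
  have key : ∃ q e₁ e₂, ConeAngleLT φ e₁ e₂ ∧ BranchSetting.IsSubstitute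
      (⋃ j ∈ {j | j ≠ i}, P j) (⋃ j ∈ {j | j ≠ i}, N j) {e₁, e₂} q := by
    by_cases hM : ∃ M : ℝ, ∀ z, (∀ n ∈ (⋃ j ∈ {j | j ≠ i}, N j), dot n.2 (z - n.1) ≤ 0) → ‖z‖ ≤ M
    · obtain ⟨M, hM⟩ := hM
      obtain ⟨⟨q, hq⟩, hsub⟩ := B.exists_substitute hM
      obtain ⟨s₁, t₁, s₂, t₂, h₁, h₂, hc⟩ := hang q hq
      obtain ⟨z, hz⟩ := hsub s₁ t₁ s₂ t₂ h₁ h₂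
      exact ⟨z, _, _, hc, hz⟩
    · push Not at hM
      obtain ⟨z, e₁, e₂, hz, hc⟩ := B.exists_substitute_of_unbounded hM hφ hφπ
      exact ⟨z, e₁, e₂, hc, hz⟩
  obtain ⟨q, e₁, e₂, hc, hq⟩ := key
  have hq0 : q ≠ 0 := by
    rintro rfl
    have := hq.zero e₁ (by simp)
    rw [dot_zero_right] at this
    exact lt_irrefl _ this
  have hqq := dot_self_pos hq0
  have half : ∀ z, dot z (q / 2) = dot z q / 2 := by
    intro z; simp only [dot, div_ofNat_re, div_ofNat_im]; ring
  refine ⟨q, e₁, e₂, hc, ⟨?_, ?_, ?_, ?_, ?_, ?_⟩⟩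
  · intro j
    rcases eq_or_ne j i with rfl | hj
    · rw [Function.update_self]; exact Set.finite_singleton _
    · rw [Function.update_of_ne hj]; exact S.finite_nodes j
  · intro j
    rcases eq_or_ne j i with rfl | hj
    · rw [Function.update_self]; exact Set.toFinite {(q / 2, q), (q, e₁), (q, e₂)}
    · rw [Function.update_of_ne hj]; exact S.finite_halfPlanes j
  · intro j n hn
    rcases eq_or_ne j i with rfl | hj
    · rw [Function.update_self] at hn
      rcases hn with rfl | rfl | rfl
      · rw [half]; linarith
      · exact hq.zero _ (by simp)
      · exact hq.zero _ (by simp)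
    · rw [Function.update_of_ne hj] at hn; exact S.zero_mem j n hn
  · intro j k hjk n hn y hy
    rcases eq_or_ne j i with rfl | hj
    · rw [Function.update_self] at hn
      rw [Function.update_of_ne (Ne.symm hjk)] at hy
      have hy' : y ∈ ⋃ l ∈ {l | l ≠ j}, P l := Set.mem_biUnion (Ne.symm hjk : k ≠ j) hy
      rcases hn with rfl | rfl | rfl
      · rw [dot_sub_right, half, dot_comm]; linarith [hq.far y hy']
      · rw [dot_sub_right]; linarith [hq.other e₁ (by simp) y hy']
      · rw [dot_sub_right]; linarith [hq.other e₂ (by simp) y hy']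
    · rw [Function.update_of_ne hj] at hn
      rcases eq_or_ne k i with rfl | hk
      · rw [Function.update_self] at hy
        rw [Set.mem_singleton_iff.1 hy]
        exact hq.mem n (Set.mem_biUnion (hj : j ≠ k) hn)
      · rw [Function.update_of_ne hk] at hy
        exact S.compat j k hjk n hn y hy
  · intro j z hz y hy
    rcases eq_or_ne j i with rfl | hj
    · rw [Function.update_self] at hy hz
      rw [Set.mem_singleton_iff.1 hy]
      have := hz (q / 2, q) (by simp [shrunk])
      rw [dot_sub_right, half] at this
      linarith
    · rw [Function.update_of_ne hj] at hy hz
      exact S.near j z hz y hy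
  · intro j n hn e k hk hy
    rcases eq_or_ne j i with rfl | hj
    · rw [Function.update_self] at hn hy
      have := hy q rfl
      rcases hn with rfl | rfl | rfl
      · rw [half]; linarith
      · exact this
      · exact this
    · rw [Function.update_of_ne hj] at hn hy
      exact S.base j n hn e k hk hy

/-- All branches of a system of drawn trees can be shrunk to points, one by one. -/
lemma exists_shrunk_system {ι : Type*} [Finite ι] {W : ι → Type*} [∀ i, Finite (W i)]
    {x : ∀ i, W i → ℂ} {R : ∀ i, W i → W i → Prop} {r v : ∀ i, W i}
    (T : ∀ i, RootedDrawing (x i) (R i) (r i) (v i))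
    (h : ∀ i j, i ≠ j → ∀ n ∈ halfPlanes (x i) (R i), ∀ y ∈ nodes (x j) (R j),
      dot n.2 (y - n.1) < 0) {φ : ι → ℝ} (hφ : ∀ i, 0 < φ i ∧ φ i ≤ Real.pi)
    (hang : ∀ i q, (∀ s t, R i s t → 0 < dot (x i t - x i s) q) →
      ∃ s₁ t₁ s₂ t₂, R i s₁ t₁ ∧ R i s₂ t₂ ∧
        ConeAngleLT (φ i) (x i t₁ - x i s₁) (x i t₂ - x i s₂)) :
    ∃ q e₁ e₂ : ι → ℂ, (∀ i, ConeAngleLT (φ i) (e₁ i) (e₂ i)) ∧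
      IsSystem (fun i => {q i}) (fun i => shrunk (q i) (e₁ i) (e₂ i)) := by
  classical
  have := Fintype.ofFinite ι
  have main : ∀ s : Finset ι, ∃ P N, IsSystem P N ∧
      (∀ i ∉ s, P i = nodes (x i) (R i) ∧ N i = halfPlanes (x i) (R i)) ∧
      ∀ i ∈ s, ∃ q e₁ e₂, ConeAngleLT (φ i) e₁ e₂ ∧ P i = {q} ∧ N i = shrunk q e₁ e₂ := by
    intro s
    induction s using Finset.induction_on with
    | empty => exact ⟨_, _, RootedDrawing.isSystem T h, fun i _ => ⟨rfl, rfl⟩, by simp⟩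
    | insert a s ha ih =>
      obtain ⟨P, N, S, h1, h2⟩ := ih
      obtain ⟨q, e₁, e₂, hc, S'⟩ := S.exists_shrink (T a) (h1 a ha).1 (h1 a ha).2 (hφ a).1
        (hφ a).2 (hang a)
      refine ⟨_, _, S', ?_, ?_⟩
      · intro i hi
        rw [Finset.mem_insert, not_or] at hi
        rw [Function.update_of_ne hi.1, Function.update_of_ne hi.1]
        exact h1 i hi.2
      · intro i hi
        rcases eq_or_ne i a with rfl | hia
        · exact ⟨q, e₁, e₂, hc, Function.update_self .., Function.update_self ..⟩
        · rw [Function.update_of_ne hia, Function.update_of_ne hia]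
          exact h2 i ((Finset.mem_insert.1 hi).resolve_left hia)
  obtain ⟨P, N, S, -, h2⟩ := main Finset.univ
  choose q e₁ e₂ hc hP hN using fun i => h2 i (Finset.mem_univ i)
  refine ⟨q, e₁, e₂, hc, ?_⟩
  rw [show (fun i => {q i}) = P from funext fun i => (hP i).symm,
    show (fun i => shrunk (q i) (e₁ i) (e₂ i)) = N from funext fun i => (hN i).symm]
  exact S

/-! ### Rooted trees -/

section Tree

variable {W : Type*} {H : SimpleGraph W} {r : W}

/-- The edges of a graph with root `r`, directed away from the root. -/
def RootedEdge (H : SimpleGraph W) (r s t : W) : Prop := H.Adj s t ∧ H.dist r s < H.dist r t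

/-- The descendants of `d`, including `d`, in a tree with root `r`. -/
def descendants (H : SimpleGraph W) (r d : W) : Set W := {x | H.dist r x = H.dist r d + H.dist d x}

lemma self_mem_descendants (d : W) : d ∈ descendants H r d := by simp [descendants]

lemma RootedEdge.dist_eq (hc : H.Connected) {s t : W} (h : RootedEdge H r s t) :
    H.dist r t = H.dist r s + 1 := by
  have h1 := hc.dist_triangle (u := r) (v := s) (w := t)
  rw [SimpleGraph.dist_eq_one_iff_adj.2 h.1] at h1
  have := h.2
  omega

lemma parent_unique (hT : H.IsTree) {s s' t : W} (h : RootedEdge H r s t)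
    (h' : RootedEdge H r s' t) : s = s' := by
  classical
  obtain ⟨p, hp, hpl⟩ := hT.connected.exists_path_of_dist r t
  have key : ∀ s, RootedEdge H r s t → s = p.penultimate := by
    intro s h
    obtain ⟨q, hq, hql⟩ := hT.connected.exists_path_of_dist r s
    have ht : t ∉ q.support := by
      intro hmem
      have h1 := SimpleGraph.dist_le (q.takeUntil t hmem)
      have h2 := q.length_takeUntil_le_length hmem
      have := h.2
      omega
    exact hT.isAcyclic.eq_penultimate_of_adj_end hp h.1.symm
      (hT.isAcyclic.mem_support_of_ne_mem_support_of_adj_of_isPath hp hq h.1.symm ht)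
  rw [key s h, key s' h']

lemma exists_adj_dist_eq (hc : H.Connected) {d x : W} (h : d ≠ x) :
    ∃ y, H.Adj y x ∧ H.dist d x = H.dist d y + 1 := by
  obtain ⟨p, hp⟩ := hc.exists_walk_length_eq_dist d x
  have hn : ¬p.Nil := fun hnil => h hnil.eq
  refine ⟨p.penultimate, p.adj_penultimate hn, ?_⟩
  have h1 := SimpleGraph.dist_le p.dropLast
  have h2 : p.dropLast.length + 1 = p.length := by
    rw [SimpleGraph.Walk.length_dropLast_add_one hn]
  have h3 := hc.dist_triangle (u := d) (v := p.penultimate) (w := x)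
  rw [SimpleGraph.dist_eq_one_iff_adj.2 (p.adj_penultimate hn)] at h3
  omega

lemma exists_parent (hc : H.Connected) {t : W} (h : t ≠ r) : ∃ s, RootedEdge H r s t := by
  obtain ⟨s, hs, hd⟩ := exists_adj_dist_eq hc h.symm
  exact ⟨s, hs, by omega⟩

/-- The only edge between the descendants of `d` and the rest of the tree is the one from the parent
of `d` to `d`. -/
lemma eq_of_adj_of_mem_descendants (hT : H.IsTree) {c d x y : W} (hcd : RootedEdge H r c d)
    (hx : x ∈ descendants H r d) (hy : y ∉ descendants H r d) (h : H.Adj x y) : x = d ∧ y = c := by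
  have hc := hT.connected
  have hx' : H.dist r x = H.dist r d + H.dist d x := hx
  have key : RootedEdge H r y x := by
    refine ⟨h.symm, ?_⟩
    by_contra hcon
    have h1 := hT.dist_ne_of_adj r h
    have h2 : RootedEdge H r x y := ⟨h, by omega⟩
    refine hy ?_
    have h3 := h2.dist_eq hc
    have h4 := hc.dist_triangle (u := d) (v := x) (w := y)
    have h5 := hc.dist_triangle (u := r) (v := d) (w := y)
    rw [SimpleGraph.dist_eq_one_iff_adj.2 h] at h4
    show H.dist r y = H.dist r d + H.dist d y
    omega
  have hxd : x = d := by
    by_contra hne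
    obtain ⟨z, hz, hzd⟩ := exists_adj_dist_eq hc (Ne.symm hne)
    have h3 := hc.dist_triangle (u := r) (v := d) (w := z)
    have h6 := hc.dist_triangle (u := r) (v := z) (w := x)
    rw [SimpleGraph.dist_eq_one_iff_adj.2 hz] at h6
    have : z = y := parent_unique hT ⟨hz, by omega⟩ key
    refine hy (this ▸ ?_)
    show H.dist r z = H.dist r d + H.dist d z
    omega
  subst hxd
  exact ⟨rfl, parent_unique hT key hcd⟩

lemma descendants_subset (hc : H.Connected) {s t : W} (h : RootedEdge H r s t) :
    descendants H r t ⊆ descendants H r s := by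
  intro x hx
  have hx' : H.dist r x = H.dist r t + H.dist t x := hx
  have h1 := h.dist_eq hc
  have h2 := hc.dist_triangle (u := s) (v := t) (w := x)
  rw [SimpleGraph.dist_eq_one_iff_adj.2 h.1] at h2
  have h3 := hc.dist_triangle (u := r) (v := s) (w := x)
  show H.dist r x = H.dist r s + H.dist s x
  omega

lemma not_mem_descendants {s t : W} (h : RootedEdge H r s t) :
    s ∉ descendants H r t := by
  intro hs
  have hs' : H.dist r s = H.dist r t + H.dist t s := hs
  have := h.2
  omega

lemma root_not_mem_descendants {s t : W} (h : RootedEdge H r s t) :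
    r ∉ descendants H r t := by
  intro hs
  have hs' : H.dist r r = H.dist r t + H.dist t r := hs
  rw [SimpleGraph.dist_self] at hs'
  have := h.2
  omega

lemma rootedEdge_root (h : H.Adj r s) : RootedEdge H r r s :=
  ⟨h, by rw [SimpleGraph.dist_self, SimpleGraph.dist_eq_one_iff_adj.2 h]; exact one_pos⟩

/-- Induction along the edges of a tree whose root has degree one. -/
lemma RootedEdge.induct (hc : H.Connected) {v : W} (hdeg : ∀ w, H.Adj r w → w = v)
    (Q : W → W → Prop) (h0 : Q r v)
    (hs : ∀ s t u, RootedEdge H r s t → RootedEdge H r t u → Q s t → Q t u) :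
    ∀ s t, RootedEdge H r s t → Q s t := by
  have : ∀ k s t, H.dist r s = k → RootedEdge H r s t → Q s t := by
    intro k
    induction k with
    | zero =>
      intro s t hk h
      have : r = s := hc.dist_eq_zero_iff.1 hk
      subst this
      rw [hdeg t h.1]; exact h0
    | succ k ih =>
      intro s t hk h
      have hne : s ≠ r := by rintro rfl; rw [SimpleGraph.dist_self] at hk; omega
      obtain ⟨p, hp⟩ := exists_parent hc hne
      have := hp.dist_eq hc
      exact hs p s t hp h (ih p s (by omega) hp)
  exact fun s t h => this _ s t rfl h

lemma mem_awayEdges_iff {v s t : W} :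
    (s, t) ∈ awayEdges H r v ↔ RootedEdge H r s t ∧ (s, t) ≠ (r, v) := by
  simp only [awayEdges, RootedEdge, Set.mem_ofPred_eq, and_assoc]

end Tree

/-! ### Greedy drawings of unions of trees -/

/-- If `dc` is the only edge that leaves `D`, then in a greedy drawing every node outside of `D` is
closer to `c` than to `d`: the node of `D` closest to it has a closer neighbour, which is outside
of `D`. -/
lemma IsGreedy.dist_lt {V : Type*} [Finite V] {G : SimpleGraph V} {Γ : V → ℂ} (hΓ : IsGreedy G Γ)
    {D : Set V} {c d t : V} (hd : d ∈ D) (hD : ∀ x ∈ D, ∀ y ∉ D, G.Adj x y → x = d ∧ y = c)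
    (ht : t ∉ D) : dist (Γ c) (Γ t) < dist (Γ d) (Γ t) := by
  obtain ⟨s, hs, hmin⟩ := Set.exists_min_image D (fun x => dist (Γ x) (Γ t)) (Set.toFinite D)
    ⟨d, hd⟩
  obtain ⟨u, hu, hlt⟩ := hΓ s t (fun h => ht (h ▸ hs))
  have huD : u ∉ D := fun h => absurd (hmin u h) (not_le.2 hlt)
  obtain ⟨rfl, rfl⟩ := hD s hs u huD hu
  exact hlt

/-- The trees `T i` have the common root `r` with root edges `r (v i)`, share no other nodes, and
their union is `G`. -/
structure IsRootedUnion {V : Type*} {G : SimpleGraph V} {n : ℕ} (T : Fin n → G.Subgraph) (r : V)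
    (v : Fin n → V) : Prop where
  tree : ∀ i, (T i).coe.IsTree
  adj : ∀ i, (T i).Adj r (v i)
  deg : ∀ i w, (T i).Adj r w → w = v i
  inter : ∀ i j, i ≠ j → (T i).verts ∩ (T j).verts = {r}
  union : ⨆ i, T i = ⊤

namespace IsRootedUnion

variable {V : Type*} {G : SimpleGraph V} {n : ℕ} {T : Fin n → G.Subgraph} {r : V} {v : Fin n → V}

lemma root_mem (U : IsRootedUnion T r v) (i : Fin n) : r ∈ (T i).verts := (U.adj i).fst_mem

lemma rootedEdge (U : IsRootedUnion T r v) (i : Fin n) :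
    RootedEdge (T i).coe ⟨r, U.root_mem i⟩ ⟨r, U.root_mem i⟩ ⟨v i, (U.adj i).snd_mem⟩ :=
  rootedEdge_root (show (T i).coe.Adj _ _ from U.adj i)

lemma exists_adj (U : IsRootedUnion T r v) {x y : V} (h : G.Adj x y) : ∃ k, (T k).Adj x y := by
  have : (⨆ i, T i).Adj x y := by rw [U.union]; exact h
  simpa using this

lemma eq_root (U : IsRootedUnion T r v) {i j : Fin n} (hij : i ≠ j) {x : V}
    (hi : x ∈ (T i).verts) (hj : x ∈ (T j).verts) : x = r := by
  have : x ∈ (T i).verts ∩ (T j).verts := ⟨hi, hj⟩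
  rwa [U.inter i j hij] at this

lemma eq_of_adj (U : IsRootedUnion T r v) {i : Fin n} {c d : (T i).verts}
    (h : RootedEdge (T i).coe ⟨r, U.root_mem i⟩ c d) {x y : V}
    (hx : x ∈ Subtype.val '' descendants (T i).coe ⟨r, U.root_mem i⟩ d)
    (hy : y ∉ Subtype.val '' descendants (T i).coe ⟨r, U.root_mem i⟩ d) (hxy : G.Adj x y) :
    x = d ∧ y = c := by
  obtain ⟨k, hk⟩ := U.exists_adj hxy
  obtain ⟨x', hx', rfl⟩ := hx
  rcases eq_or_ne k i with rfl | hki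
  · have hy' : (⟨y, hk.snd_mem⟩ : (T k).verts) ∉ descendants (T k).coe ⟨r, U.root_mem k⟩ d :=
      fun hmem => hy ⟨_, hmem, rfl⟩
    obtain ⟨h1, h2⟩ := eq_of_adj_of_mem_descendants (U.tree k) h hx' hy' hk
    exact ⟨congrArg _ h1, congrArg Subtype.val h2⟩
  · have := U.eq_root hki hk.fst_mem x'.2
    have hr : x' = ⟨r, U.root_mem i⟩ := Subtype.ext this
    exact absurd (hr ▸ hx') (root_not_mem_descendants h)

lemma dist_parent_lt [Finite V] (U : IsRootedUnion T r v) {Γ : V → ℂ} (hΓ : IsGreedy G Γ)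
    {i : Fin n} {c d : (T i).verts} (h : RootedEdge (T i).coe ⟨r, U.root_mem i⟩ c d) {t : V}
    (ht : t ∉ Subtype.val '' descendants (T i).coe ⟨r, U.root_mem i⟩ d) :
    dist (Γ c) (Γ t) < dist (Γ d) (Γ t) :=
  hΓ.dist_lt (D := Subtype.val '' descendants (T i).coe ⟨r, U.root_mem i⟩ d)
    ⟨d, self_mem_descendants d, rfl⟩ (fun _ hx _ hy hxy => U.eq_of_adj h hx hy hxy) ht

lemma dist_child_lt [Finite V] (U : IsRootedUnion T r v) {Γ : V → ℂ} (hΓ : IsGreedy G Γ)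
    {i : Fin n} {c d t : (T i).verts} (h : RootedEdge (T i).coe ⟨r, U.root_mem i⟩ c d)
    (ht : t ∈ descendants (T i).coe ⟨r, U.root_mem i⟩ d) :
    dist (Γ d) (Γ t) < dist (Γ c) (Γ t) := by
  refine hΓ.dist_lt (D := (Subtype.val '' descendants (T i).coe ⟨r, U.root_mem i⟩ d)ᶜ)
    ?_ (fun x hx y hy hxy => ?_) (not_not.2 ⟨t, ht, rfl⟩)
  · rintro ⟨c', hc', hcc⟩
    rw [Subtype.ext hcc] at hc'
    exact not_mem_descendants h hc'
  · exact (U.eq_of_adj h (not_not.1 hy) hx hxy.symm).symm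

/-- A greedy drawing with the root at the origin satisfies the conditions of `RootedDrawing` on each
of the trees. -/
lemma rootedDrawing [Finite V] (U : IsRootedUnion T r v) {Γ : V → ℂ} (hΓ : IsGreedy G Γ)
    (h0 : Γ r = 0) (i : Fin n) :
    RootedDrawing (fun w : (T i).verts => Γ w) (RootedEdge (T i).coe ⟨r, U.root_mem i⟩)
      ⟨r, U.root_mem i⟩ ⟨v i, (U.adj i).snd_mem⟩ := by
  have hc := (U.tree i).connected
  have hdeg : ∀ w, (T i).coe.Adj ⟨r, U.root_mem i⟩ w → w = ⟨v i, (U.adj i).snd_mem⟩ :=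
    fun w hw => Subtype.ext (U.deg i _ hw)
  have val : ∀ {w : (T i).verts} {d}, w ∉ descendants (T i).coe ⟨r, U.root_mem i⟩ d →
      (w : V) ∉ Subtype.val '' descendants (T i).coe ⟨r, U.root_mem i⟩ d := by
    rintro w d hw ⟨w', hw', e⟩
    rw [Subtype.ext e] at hw'
    exact hw hw'
  refine ⟨h0, U.rootedEdge i, RootedEdge.induct hc hdeg, ?_, ?_, ?_⟩
  · intro s t hst
    rw [← dist_lt_dist_iff_dot, ← h0]
    exact U.dist_parent_lt hΓ hst (t := r) (val (root_not_mem_descendants hst))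
  · intro s t u hst htu
    have h1 := U.dist_child_lt hΓ hst (descendants_subset hc htu |>.trans subset_rfl <|
      self_mem_descendants u : u ∈ descendants (T i).coe ⟨r, U.root_mem i⟩ t)
    have h2 := U.dist_parent_lt hΓ htu (val fun hs =>
      not_mem_descendants hst (descendants_subset hc htu hs))
    rw [dist_eq_norm, dist_eq_norm, norm_lt_norm_iff_dot] at h1 h2
    simp only [dot, sub_re, sub_im] at h1 h2 ⊢
    constructor <;> nlinarith
  · intro s t hst hs
    obtain ⟨p, hp⟩ := exists_parent hc hs
    -- the distance to a node decreases along the path from the root to the node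
    have key := RootedEdge.induct hc hdeg
      (fun _ t => ∀ x ∈ descendants (T i).coe ⟨r, U.root_mem i⟩ t,
        dist (Γ t) (Γ x) < dist (Γ r) (Γ x))
      (fun x hx => U.dist_child_lt hΓ (U.rootedEdge i) hx)
      (fun a b c _ hbc ih x hx =>
        (U.dist_child_lt hΓ hbc hx).trans (ih x (descendants_subset hc hbc hx)))
      p s hp t (descendants_subset hc hst (self_mem_descendants t))
    rw [dist_eq_norm, dist_eq_norm, norm_lt_norm_iff_dot, h0] at key
    simp only [dot, sub_re, sub_im, zero_re, zero_im] at key ⊢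
    nlinarith

/-- The half-planes of the edges of a tree contain the nodes of the other trees. -/
lemma compat [Finite V] (U : IsRootedUnion T r v) {Γ : V → ℂ} (hΓ : IsGreedy G Γ)
    {i j : Fin n} (hij : i ≠ j) :
    ∀ m ∈ halfPlanes (fun w : (T i).verts => Γ w) (RootedEdge (T i).coe ⟨r, U.root_mem i⟩),
    ∀ y ∈ nodes (fun w : (T j).verts => Γ w) (RootedEdge (T j).coe ⟨r, U.root_mem j⟩),
      dot m.2 (y - m.1) < 0 := by
  rintro _ ⟨c, d, hcd, rfl⟩ _ ⟨s, t, hst, rfl⟩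
  show dot (Γ d - Γ c) (Γ t - (Γ c + Γ d) / 2) < 0
  rw [← dist_lt_dist_iff_dot]
  refine U.dist_parent_lt hΓ hcd ?_
  rintro ⟨t', ht', e⟩
  have h1 := U.eq_root hij (e ▸ t'.2) t.2
  have h2 : t' = ⟨r, U.root_mem i⟩ := Subtype.ext (e.trans h1)
  exact root_not_mem_descendants hcd (h2 ▸ ht')

end IsRootedUnion

lemma coneAngleLT_pi (e : ℂ) : ConeAngleLT Real.pi e e := by
  intro w w' h _ h' _
  refine lt_of_le_of_ne (InnerProductGeometry.angle_le_pi _ _) fun hp => ?_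
  obtain ⟨-, k, hk, rfl⟩ := InnerProductGeometry.angle_eq_pi_iff.1 hp
  rw [Complex.real_smul, dot_smul_right] at h'
  nlinarith

/-- If all edges of a rooted tree form acute angles with some direction, then its two extremal
edges bound a cone whose angle is the opening angle. -/
lemma exists_coneAngleLT {W : Type*} [Finite W] {H : SimpleGraph W} {r v : W} {Γ : W → ℂ}
    {φ : ℝ} (hφ : φ ≤ Real.pi) (hlt : openingAngle H r v Γ < φ) {q : ℂ}
    (hrv : RootedEdge H r r v) (hq : ∀ s t, RootedEdge H r s t → 0 < dot (Γ t - Γ s) q) :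
    ∃ s₁ t₁ s₂ t₂, RootedEdge H r s₁ t₁ ∧ RootedEdge H r s₂ t₂ ∧
      ConeAngleLT φ (Γ t₁ - Γ s₁) (Γ t₂ - Γ s₂) := by
  unfold openingAngle at hlt
  split_ifs at hlt with hne
  swap
  · exact absurd (hlt.trans_le hφ) (lt_irrefl _)
  obtain ⟨⟨s₁, t₁⟩, h₁, e₁⟩ := (hne.image
    (fun e : W × W => ccwTurn (Γ e.2 - Γ e.1) (Γ r - Γ v))).csInf_mem (Set.toFinite _)
  obtain ⟨⟨s₂, t₂⟩, h₂, e₂⟩ := (hne.image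
    (fun e : W × W => ccwTurn (Γ r - Γ v) (Γ e.2 - Γ e.1))).csInf_mem (Set.toFinite _)
  rw [← e₁, ← e₂] at hlt
  have r₁ := (mem_awayEdges_iff.1 h₁).1
  have r₂ := (mem_awayEdges_iff.1 h₂).1
  refine ⟨s₁, t₁, s₂, t₂, r₁, r₂, fun w w' a b c d => ?_⟩
  have p₁ := hq _ _ r₁
  have p₂ := hq _ _ r₂
  have pv := hq _ _ hrv
  have hd : Γ r - Γ v ≠ 0 := by
    intro h
    rw [← neg_sub, h] at pv
    simp [dot] at pv
  have n₁ : Γ t₁ - Γ s₁ ≠ 0 := fun h => by rw [h] at p₁; simp [dot] at p₁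
  have n₂ : Γ t₂ - Γ s₂ ≠ 0 := fun h => by rw [h] at p₂; simp [dot] at p₂
  have hgt := pi_lt_ccwTurn_add_ccwTurn (d := Γ r - Γ v) (e₁ := Γ t₁ - Γ s₁)
    (e₂ := Γ t₂ - Γ s₂) (w := -q)
    (by rw [dot_neg_right, ← dot_neg_left, neg_sub]; exact pv)
    (by rw [dot_neg_right]; linarith) (by rw [dot_neg_right]; linarith)
  simp only at hlt
  have := angle_lt_of_dot_neg hd (hasTurn_ccwTurn n₁ hd).symm (hasTurn_ccwTurn hd n₂) hgt
    (by linarith) a b c d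
  linarith

lemma openingAngle_sub_const {W : Type*} (H : SimpleGraph W) (r v : W) (Γ : W → ℂ) (c : ℂ) :
    openingAngle H r v (fun x => Γ x - c) = openingAngle H r v Γ := by
  simp only [openingAngle, sub_sub_sub_cancel_right]

lemma IsGreedy.sub_const {W : Type*} {H : SimpleGraph W} {Γ : W → ℂ} (h : IsGreedy H Γ) (c : ℂ) :
    IsGreedy H (fun x => Γ x - c) := by
  intro s t hst
  obtain ⟨u, hu, hlt⟩ := h s t hst
  exact ⟨u, hu, by simpa using hlt⟩

/-- A greedy drawing of the union of trees yields points in the plane, one for each tree, that are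
exposed with respect to each other and the origin, see each other within angles less than `φ i`,
and are the leaves of a greedily drawn star with center at the origin. -/
lemma IsRootedUnion.exists_points {V : Type*} [Finite V] {G : SimpleGraph V} {n : ℕ}
    {T : Fin n → G.Subgraph} {r : V} {v : Fin n → V} (U : IsRootedUnion T r v) {Γ : V → ℂ}
    (hΓ : IsGreedy G Γ) {φ : Fin n → ℝ} (hφ : ∀ i, 0 < φ i ∧ φ i ≤ Real.pi)
    (hang : ∀ i, φ i = Real.pi ∨ subtreeAngle (T i) (U.adj i) (fun x => Γ x) < φ i) :
    ∃ q : Fin n → ℂ, (∀ i j, i ≠ j → ‖q i‖ < ‖q i - q j‖) ∧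
      (∀ i, ∃ e, 0 < dot e (q i) ∧ ∀ j, j ≠ i → dot e (q j) < dot e (q i)) ∧
      ∀ i j k, j ≠ i → k ≠ i → InnerProductGeometry.angle (q j - q i) (q k - q i) < φ i := by
  have D := U.rootedDrawing (hΓ.sub_const (Γ r)) (sub_self _)
  obtain ⟨q, e₁, e₂, hc, S⟩ := exists_shrunk_system D
    (fun i j hij => U.compat (hΓ.sub_const (Γ r)) hij) hφ (by
      intro i q hq
      rcases hang i with h | h
      · exact ⟨_, _, _, _, U.rootedEdge i, U.rootedEdge i,
          h ▸ coneAngleLT_pi _⟩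
      · refine exists_coneAngleLT (hφ i).2 (v := ⟨v i, (U.adj i).snd_mem⟩) ?_
          (U.rootedEdge i) hq
        rw [openingAngle_sub_const (T i).coe _ _ (fun x : (T i).verts => Γ x)]
        exact h)
  -- the half-plane `(q j / 2, q j)` says that `q i` is closer to the origin than to `q j`
  refine ⟨q, fun i j hij => ?_, fun i => ⟨e₁ i, ?_, fun j hj => ?_⟩, fun i j k hj hk => ?_⟩
  · have := S.compat j i (Ne.symm hij) (q j / 2, q j) (by simp [shrunk]) (q i) rfl
    rw [norm_lt_norm_iff_dot]
    simp only [dot, sub_re, sub_im, div_ofNat_re, div_ofNat_im] at this ⊢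
    nlinarith
  · exact S.zero_mem i (q i, e₁ i) (by simp [shrunk])
  · have := S.compat i j (Ne.symm hj) (q i, e₁ i) (by simp [shrunk]) (q j) rfl
    rw [dot_sub_right] at this
    linarith
  · have m₁ : (q i, e₁ i) ∈ shrunk (q i) (e₁ i) (e₂ i) := by simp [shrunk]
    have m₂ : (q i, e₂ i) ∈ shrunk (q i) (e₁ i) (e₂ i) := by simp [shrunk]
    exact hc i _ _ (S.compat i j (Ne.symm hj) _ m₁ _ rfl) (S.compat i j (Ne.symm hj) _ m₂ _ rfl)
      (S.compat i k (Ne.symm hk) _ m₁ _ rfl) (S.compat i k (Ne.symm hk) _ m₂ _ rfl)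

/-! ### Stars and convex polygons -/

lemma starGraph_none_isGreedy {n : ℕ} {Q : Fin n → ℂ} (h0 : ∀ i, Q i ≠ 0)
    (hstar : ∀ i j, i ≠ j → ‖Q i‖ < ‖Q i - Q j‖) :
    IsGreedy (SimpleGraph.starGraph (none : Option (Fin n))) (fun o => o.elim 0 Q) := by
  rintro (_ | i) (_ | j) hst
  · exact absurd rfl hst
  · refine ⟨some j, SimpleGraph.starGraph_adj.2 ⟨hst, Or.inl rfl⟩, ?_⟩
    simpa using h0 j
  · refine ⟨none, SimpleGraph.starGraph_adj.2 ⟨hst, Or.inr rfl⟩, ?_⟩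
    simpa using h0 i
  · refine ⟨none, SimpleGraph.starGraph_adj.2 ⟨by simp, Or.inr rfl⟩, ?_⟩
    have := hstar j i (fun h => hst (by rw [h]))
    simpa [dist_eq_norm, norm_sub_rev] using this

/-- If no closed half-plane bounded by a line through the origin contains all of the points, then
the origin is in the interior of their convex hull. -/
lemma zero_mem_interior_convexHull {n : ℕ} {Q : Fin n → ℂ}
    (hsurr : ∀ u : ℂ, u ≠ 0 → ∃ i, 0 < dot u (Q i)) :
    0 ∈ interior (convexHull ℝ (Set.range Q)) := by
  obtain ⟨i₀, -⟩ := hsurr 1 one_ne_zero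
  have hne : (Finset.univ : Finset (Fin n)).Nonempty := ⟨i₀, Finset.mem_univ _⟩
  have hcont : Continuous fun u : ℂ => Finset.univ.sup' hne fun i => dot u (Q i) :=
    Continuous.finset_sup'_apply hne fun i _ => by unfold dot; fun_prop
  obtain ⟨u₀, hu₀, hmin⟩ := (isCompact_sphere (0 : ℂ) 1).exists_isMinOn
    ⟨1, by simp⟩ hcont.continuousOn
  set δ := Finset.univ.sup' hne fun i => dot u₀ (Q i) with hδ
  have hδ0 : 0 < δ := by
    obtain ⟨i, hi⟩ := hsurr u₀ (by rintro rfl; simp at hu₀)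
    exact (Finset.lt_sup'_iff hne).2 ⟨i, Finset.mem_univ _, hi⟩
  have hmax : ∀ w : ℂ, ∃ i, δ * ‖w‖ ≤ dot w (Q i) := by
    intro w
    rcases eq_or_ne w 0 with rfl | hw
    · exact ⟨i₀, by simp [dot]⟩
    · have hw' : 0 < ‖w‖ := norm_pos_iff.2 hw
      have hu : ((‖w‖⁻¹ : ℝ) : ℂ) * w ∈ Metric.sphere (0 : ℂ) 1 := by
        simp [hw'.ne']
      obtain ⟨i, -, hi⟩ := Finset.exists_mem_eq_sup' hne
        (fun i => dot (((‖w‖⁻¹ : ℝ) : ℂ) * w) (Q i))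
      have h1 : δ ≤ _ := (hmin hu).trans_eq hi
      rw [dot_smul_left] at h1
      refine ⟨i, ?_⟩
      calc δ * ‖w‖ ≤ ‖w‖⁻¹ * dot w (Q i) * ‖w‖ := mul_le_mul_of_nonneg_right h1 hw'.le
        _ = dot w (Q i) := by field_simp
  rw [mem_interior]
  refine ⟨Metric.ball 0 δ, fun x hx => ?_, Metric.isOpen_ball, Metric.mem_ball_self hδ0⟩
  by_contra hcon
  obtain ⟨f, t, hft, htx⟩ := geometric_hahn_banach_closed_point (convex_convexHull ℝ _)
    ((Set.finite_range Q).isCompact_convexHull ℝ).isClosed hcon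
  have hf : ∀ z : ℂ, f z = dot ⟨f 1, f I⟩ z := by
    intro z
    have : z = z.re • (1 : ℂ) + z.im • I := by simp [Complex.re_add_im]
    conv_lhs => rw [this]
    rw [map_add, map_smul, map_smul]
    simp [dot]; ring
  set w : ℂ := ⟨f 1, f I⟩
  obtain ⟨i, hi⟩ := hmax w
  have h1 := hft _ (subset_convexHull ℝ _ ⟨i, rfl⟩)
  rw [hf] at h1 htx
  have h2 := dot_le_norm_mul_norm w x
  rw [mem_ball_zero_iff] at hx
  nlinarith [norm_nonneg w, mul_le_mul_of_nonneg_left hx.le (norm_nonneg w)]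

/-- The neighbours of `P k` in the cyclic order of points sorted by their argument. -/
lemma exists_gap {n : ℕ} (hn : 2 ≤ n) {P : Fin n → ℂ} (h0 : ∀ i, P i ≠ 0)
    (hmono : StrictMono fun i => (P i).arg) (k : Fin n) :
    ∃ g ∈ Set.Ioo 0 (2 * Real.pi), HasTurn (P k) (P (finRotate n k)) g ∧
      ∀ j, j ≠ k → j ≠ finRotate n k → ∃ o ∈ Set.Ioo g (2 * Real.pi), HasTurn (P k) (P j) o := by
  obtain ⟨m, rfl⟩ : ∃ m, n = m + 2 := ⟨n - 2, by omega⟩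
  have turn : ∀ i j, HasTurn (P i) (P j) ((P j).arg - (P i).arg) := by
    have h1 : ∀ i, HasTurn 1 (P i) (P i).arg := fun i => by
      have := hasTurn_arg one_ne_zero (h0 i)
      rwa [div_one] at this
    exact fun i j => ((h1 i).symm.trans (h1 j)).congr (by ring)
  have turn' : ∀ i j, HasTurn (P i) (P j) ((P j).arg - (P i).arg + 2 * Real.pi) :=
    fun i j => ((turn i j).add_int_mul 1).congr (by push_cast; ring)
  have lo := fun i => Complex.neg_pi_lt_arg (P i)
  have hi := fun i => Complex.arg_le_pi (P i)
  rcases eq_or_ne k (Fin.last (m + 1)) with rfl | hk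
  · rw [finRotate_last]
    have hlt := hmono (Fin.last_pos : (0 : Fin (m + 2)) < Fin.last (m + 1))
    refine ⟨_, ⟨?_, ?_⟩, turn' _ _, fun j hj hj' => ⟨_, ⟨?_, ?_⟩, turn' _ _⟩⟩
    · linarith [lo 0, hi (Fin.last (m + 1))]
    · simp only at hlt; linarith
    · have := hmono (Fin.pos_iff_ne_zero.2 hj')
      simp only at this; linarith
    · have := hmono (Fin.lt_last_iff_ne_last.2 hj)
      simp only at this; linarith
  · have hval : (finRotate (m + 2) k : ℕ) = k + 1 := coe_finRotate_of_ne_last hk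
    have hlt := hmono (show k < finRotate (m + 2) k by rw [Fin.lt_def, hval]; omega)
    simp only at hlt
    refine ⟨_, ⟨?_, ?_⟩, turn _ _, fun j hj hj' => ?_⟩
    · linarith
    · linarith [lo k, hi (finRotate (m + 2) k)]
    · rcases lt_or_gt_of_ne hj with h | h
      · have := hmono h
        simp only at this
        refine ⟨_, ⟨?_, ?_⟩, turn' _ _⟩
        · linarith [lo j, hi (finRotate (m + 2) k)]
        · linarith
      · have h' : finRotate (m + 2) k < j := by
          rw [Fin.lt_def, hval]
          have := Fin.val_ne_of_ne hj'
          rw [hval] at this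
          rw [Fin.lt_def] at h
          omega
        have := hmono h'
        simp only at this
        refine ⟨_, ⟨?_, ?_⟩, turn _ _⟩
        · linarith
        · linarith [lo k, hi j]

/-- Points that surround the origin and are exposed with respect to each other and the origin form a
convex polygon when sorted by argument: if some point were not to the left of the line through two
consecutive points, one of these two would lie in the convex hull of the other one, that point and
the origin. -/
lemma isConvexPolygon_of_exposed {n : ℕ} (hn : 2 ≤ n) {P : Fin n → ℂ}
    (hexp : ∀ i, ∃ e, 0 < dot e (P i) ∧ ∀ j, j ≠ i → dot e (P j) < dot e (P i))
    (hsurr : ∀ u : ℂ, u ≠ 0 → ∃ i, 0 < dot u (P i))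
    (hmono : StrictMono fun i => (P i).arg) : IsConvexPolygon P := by
  have h0 : ∀ i, P i ≠ 0 := by
    intro i h
    obtain ⟨e, he, -⟩ := hexp i
    rw [h, dot_zero_right] at he
    exact lt_irrefl _ he
  intro k j hj hj'
  rw [← crs_eq_im]
  obtain ⟨g, ⟨hg0, hg1⟩, hg, hother⟩ := exists_gap hn h0 hmono k
  -- the gap to the next point is less than `π`, otherwise a half-plane contains all points
  have hgπ : g < Real.pi := by
    by_contra hcon
    obtain ⟨i, hi⟩ := hsurr (I * P k) (mul_ne_zero I_ne_zero (h0 k))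
    have e : dot (I * P k) (P i) = crs (P k) (P i) := by simp [dot, crs]; ring
    rw [e] at hi
    have key : ∀ o, HasTurn (P k) (P i) o → Real.pi ≤ o → o < 2 * Real.pi → False := by
      intro o ho h1 h2
      have := ((hasTurn_self (P k)).crs_pos_iff ho (h0 k)).1 hi
      rw [sub_zero] at this
      have h3 := Real.sin_nonpos_of_nonpos_of_neg_pi_le (x := o - 2 * Real.pi) (by linarith)
        (by linarith)
      rw [Real.sin_sub_two_pi] at h3
      linarith
    by_cases hik : i = k
    · subst hik
      have : crs (P i) (P i) = 0 := by unfold crs; ring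
      linarith
    · by_cases hik' : i = finRotate n k
      · subst hik'
        exact key g hg (not_lt.1 hcon) hg1
      · obtain ⟨o, ⟨ho1, ho2⟩, ho⟩ := hother i hik hik'
        exact key o ho (by linarith) ho2
  obtain ⟨o, ⟨ho1, ho2⟩, ho⟩ := hother j hj hj'
  set p := P k
  set p' := P (finRotate n k)
  have hD : 0 < crs p p' := by
    rw [(hasTurn_self p).crs_pos_iff hg (h0 k), sub_zero]
    exact Real.sin_pos_of_pos_of_lt_pi hg0 hgπ
  have hkk' : finRotate n k ≠ k := by
    intro h
    have : crs p p' = 0 := by simp only [p, p', h, crs]; ring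
    linarith
  have e1 : crs (p' - p) (P j - p) = crs p p' - crs (P j) p' - crs p (P j) := by
    simp [crs]; ring
  have e2 : ∀ e, crs p p' * dot e (P j) = crs (P j) p' * dot e p + crs p (P j) * dot e p' := by
    intro e; simp [crs, dot]; ring
  rw [e1]
  by_contra hcon
  obtain ⟨e, he, hej⟩ := hexp k
  obtain ⟨e', he', hej'⟩ := hexp (finRotate n k)
  have a1 := hej j hj
  have a2 := hej _ hkk'
  have b1 := hej' j hj'
  have b2 := hej' k (Ne.symm hkk')
  have c1 := e2 e
  have c2 := e2 e'
  -- `P j = (a p + b p') / D` with `D = crs p p'`, `a = crs (P j) p'`, `b = crs p (P j)` and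
  -- `a + b ≥ D`, where `a` and `b` are not both nonnegative
  rcases lt_or_ge (crs p (P j)) 0 with hb | hb
  · nlinarith
  · have hoπ : o ≤ Real.pi := by
      by_contra hc
      obtain ⟨κ, hκ, -, h⟩ := (hasTurn_self p).dot_eq ho (h0 k)
      have h3 := Real.sin_neg_of_neg_of_neg_pi_lt (x := o - 2 * Real.pi) (by linarith)
        (by linarith)
      rw [Real.sin_sub_two_pi] at h3
      rw [h, sub_zero] at hb
      nlinarith
    have ha : crs (P j) p' < 0 := by
      obtain ⟨κ, hκ, -, h⟩ := ho.dot_eq hg (h0 k)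
      have h3 := Real.sin_neg_of_neg_of_neg_pi_lt (x := g - o) (by linarith) (by linarith)
      change crs (P j) p' = _ at h
      rw [h]
      nlinarith
    nlinarith

lemma finRotate_ne_self {n : ℕ} (hn : 2 ≤ n) (k : Fin n) : finRotate n k ≠ k := by
  obtain ⟨m, rfl⟩ : ∃ m, n = m + 2 := ⟨n - 2, by omega⟩
  have := support_finRotate (n := m)
  have h : k ∈ (finRotate (m + 2)).support := by rw [this]; exact Finset.mem_univ _
  exact Equiv.Perm.mem_support.1 h

lemma finRotate_symm_ne_self {n : ℕ} (hn : 2 ≤ n) (k : Fin n) : (finRotate n).symm k ≠ k := by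
  intro h
  have := finRotate_ne_self hn ((finRotate n).symm k)
  rw [Equiv.apply_symm_apply] at this
  exact this h.symm

/-- The star with center at the origin and leaves `Q i` is as required in `InP` if the leaves are
exposed, surround the origin and see each other within angles less than `φ i`. -/
lemma inP_of_points {n : ℕ} (hn : 2 ≤ n) {φ : Fin n → ℝ} {Q : Fin n → ℂ}
    (hstar : ∀ i j, i ≠ j → ‖Q i‖ < ‖Q i - Q j‖)
    (hexp : ∀ i, ∃ e, 0 < dot e (Q i) ∧ ∀ j, j ≠ i → dot e (Q j) < dot e (Q i))
    (hsurr : ∀ u : ℂ, u ≠ 0 → ∃ i, 0 < dot u (Q i))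
    (hang : ∀ i j k, j ≠ i → k ≠ i → InnerProductGeometry.angle (Q j - Q i) (Q k - Q i) < φ i) :
    InP n φ := by
  have h0 : ∀ i, Q i ≠ 0 := by
    intro i h
    obtain ⟨e, he, -⟩ := hexp i
    rw [h, dot_zero_right] at he
    exact lt_irrefl _ he
  set σ := Tuple.sort fun i => (Q i).arg with hσ
  have hmono : StrictMono fun i => (Q (σ i)).arg := by
    refine (Tuple.monotone_sort fun i => (Q i).arg).strictMono_of_injective fun i j hij => ?_
    -- of two leaves in the same direction, one is closer to the other than the center is
    by_contra hne
    have hne' : σ i ≠ σ j := fun h => hne (σ.injective h)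
    have h1 := (Complex.arg_eq_arg_iff (h0 (σ i)) (h0 (σ j))).1 hij
    have s1 := (norm_lt_norm_iff_dot _ _).1 (hstar _ _ hne')
    have s2 := (norm_lt_norm_iff_dot _ _).1 (hstar _ _ hne'.symm)
    have hp := dot_self_pos (h0 (σ i))
    have hc : (0 : ℝ) < ‖Q (σ j)‖ / ‖Q (σ i)‖ :=
      div_pos (norm_pos_iff.2 (h0 _)) (norm_pos_iff.2 (h0 _))
    rw [← Complex.ofReal_div] at h1
    rw [← h1] at s1 s2
    simp only [dot_sub_left, dot_sub_right, dot_smul_left, dot_smul_right] at s1 s2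
    set c := ‖Q (σ j)‖ / ‖Q (σ i)‖
    have t1 : 0 < dot (Q (σ i)) (Q (σ i)) * (c ^ 2 - 2 * c) := by linarith
    have t2 : 0 < dot (Q (σ i)) (Q (σ i)) * (1 - 2 * c) := by linarith
    have t3 := pos_of_mul_pos_right t1 hp.le
    have t4 := pos_of_mul_pos_right t2 hp.le
    nlinarith
  refine ⟨fun o => o.elim 0 Q, starGraph_none_isGreedy h0 hstar, σ, ?_, ?_, ?_⟩
  · refine isConvexPolygon_of_exposed hn (fun i => ?_) (fun u hu => ?_) hmono
    · obtain ⟨e, he, hej⟩ := hexp (σ i)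
      exact ⟨e, he, fun j hj => hej _ fun h => hj (σ.injective h)⟩
    · obtain ⟨i, hi⟩ := hsurr u hu
      exact ⟨σ.symm i, by simpa using hi⟩
  · refine zero_mem_interior_convexHull (Q := fun k => Q (σ k)) fun u hu => ?_
    obtain ⟨i, hi⟩ := hsurr u hu
    exact ⟨σ.symm i, by simpa using hi⟩
  · intro k
    exact hang (σ k) _ _ (fun h => finRotate_symm_ne_self hn k (σ.injective h))
      (fun h => finRotate_ne_self hn k (σ.injective h))

/-- Four leaves of a greedily drawn star around the origin are not in a closed half-plane bounded by
a line through the origin: two of them would be at an angle of at most `π / 3`. -/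
lemma exists_dot_pos_of_star {n : ℕ} (hn : 4 ≤ n) {Q : Fin n → ℂ} (h0 : ∀ i, Q i ≠ 0)
    (hstar : ∀ i j, i ≠ j → ‖Q i‖ < ‖Q i - Q j‖) (u : ℂ) (hu : u ≠ 0) : ∃ i, 0 < dot u (Q i) := by
  by_contra! hcon
  have hπ := Real.pi_pos
  have hs : ∀ i, ∃ s, Real.pi / 2 ≤ s ∧ s ≤ 3 * Real.pi / 2 ∧ HasTurn u (Q i) s := by
    intro i
    obtain ⟨s, ⟨h1, h2⟩, hs⟩ := exists_hasTurn_mem_Ico hu (h0 i) (-(Real.pi / 2))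
    have hc : ¬ 0 < Real.cos (s - 0) := fun h =>
      absurd (((hasTurn_self u).dot_pos_iff hs hu).2 h) (not_lt.2 (hcon i))
    rw [sub_zero] at hc
    rcases eq_or_lt_of_le h1 with h | h
    · refine ⟨s + 2 * Real.pi, by linarith, by linarith, (hs.add_int_mul 1).congr ?_⟩
      push_cast; ring
    · refine ⟨s, ?_, by linarith, hs⟩
      by_contra hlt
      exact hc (Real.cos_pos_of_mem_Ioo ⟨by linarith, by linarith⟩)
  choose s hs1 hs2 hs using hs
  -- two leaves are in the same of three sectors of angle `π / 3`
  obtain ⟨i, j, hij, hsec⟩ := Fintype.exists_ne_map_eq_of_card_lt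
    (fun i => if s i < 5 * Real.pi / 6 then (0 : Fin 3) else
      if s i < 7 * Real.pi / 6 then 1 else 2) (by simp; omega)
  have hd : |s i - s j| ≤ Real.pi / 3 := by
    have := hs1 i; have := hs1 j; have := hs2 i; have := hs2 j
    rw [abs_le]
    split_ifs at hsec <;> first | (constructor <;> linarith) | simp at hsec
  have ha := (hs i).angle_eq (hs j) hu (by linarith)
  have hcos : 1 / 2 ≤ Real.cos (InnerProductGeometry.angle (Q i) (Q j)) := by
    rw [ha, ← Real.cos_pi_div_three]
    exact Real.cos_le_cos_of_nonneg_of_le_pi (abs_nonneg _) (by linarith) hd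
  have hin := InnerProductGeometry.cos_angle_mul_norm_mul_norm (Q i) (Q j)
  rw [inner_eq_dot] at hin
  have pi := norm_pos_iff.2 (h0 i)
  have pj := norm_pos_iff.2 (h0 j)
  have hge : 1 / 2 * (‖Q i‖ * ‖Q j‖) ≤ dot (Q i) (Q j) := by
    rw [← hin]; exact mul_le_mul_of_nonneg_right hcos (mul_pos pi pj).le
  have s1 := (norm_lt_norm_iff_dot _ _).1 (hstar i j hij)
  have s2 := (norm_lt_norm_iff_dot _ _).1 (hstar j i hij.symm)
  have e1 := dot_self_eq_norm_sq (Q i)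
  have e2 := dot_self_eq_norm_sq (Q j)
  simp only [dot_sub_left, dot_sub_right, dot_comm (Q j) (Q i)] at s1 s2
  rcases le_total ‖Q i‖ ‖Q j‖ with h | h <;> nlinarith

/-- Of three points on a line, the one in the middle is not exposed. -/
lemma crs_ne_zero_of_exposed {x y z : ℂ} (hx : ∃ e, dot e y < dot e x ∧ dot e z < dot e x)
    (hy : ∃ e, dot e x < dot e y ∧ dot e z < dot e y)
    (hz : ∃ e, dot e x < dot e z ∧ dot e y < dot e z) : crs (y - x) (z - x) ≠ 0 := by
  intro h
  obtain ⟨e, e1, e2⟩ := hx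
  obtain ⟨f, f1, f2⟩ := hy
  obtain ⟨g, g1, g2⟩ := hz
  have hb : y - x ≠ 0 := by
    intro hb
    rw [sub_eq_zero.1 hb] at e1
    exact lt_irrefl _ e1
  have key : ∀ e, dot (y - x) (y - x) * (dot e z - dot e x)
      = dot (y - x) (z - x) * (dot e y - dot e x) := by
    intro e
    have : dot (y - x) (y - x) * (dot e z - dot e x)
      - dot (y - x) (z - x) * (dot e y - dot e x) = crs (y - x) (z - x) * crs (y - x) e := by
      simp only [dot, crs, sub_re, sub_im]; ring
    rw [h, zero_mul] at this
    linarith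
  have hp := dot_self_pos hb
  set p := dot (y - x) (y - x)
  set t := dot (y - x) (z - x)
  have k1 := key e
  have k2 := key f
  have k3 := key g
  have t0 : 0 < t := by
    by_contra hc
    nlinarith
  have t1 : t < p := by
    by_contra hc
    nlinarith
  nlinarith

lemma norm_add_lt_of_crs_ne_zero {a b : ℂ} (h : crs a b ≠ 0) : ‖a + b‖ < ‖a‖ + ‖b‖ := by
  refine lt_of_pow_lt_pow_left₀ 2 (by positivity) ?_
  have h1 : dot a b ^ 2 + crs a b ^ 2 = dot a a * dot b b := by simp only [dot, crs]; ring
  have h2 : dot a b < ‖a‖ * ‖b‖ := by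
    refine lt_of_pow_lt_pow_left₀ 2 (by positivity) ?_
    rw [mul_pow, ← dot_self_eq_norm_sq, ← dot_self_eq_norm_sq, ← h1]
    have := pow_pos (abs_pos.2 h) 2
    rw [sq_abs] at this
    linarith
  rw [← dot_self_eq_norm_sq, add_sq, ← dot_self_eq_norm_sq, ← dot_self_eq_norm_sq]
  simp only [dot_add_left, dot_add_right, dot_comm b a]
  linarith

/-- The incenter of a triangle is closer to a corner than both other corners are. -/
lemma norm_sub_incenter_lt {x y z : ℂ} (h : crs (y - x) (z - x) ≠ 0) :
    ‖x - (‖y - z‖ * x + ‖z - x‖ * y + ‖x - y‖ * z) / (‖y - z‖ + ‖z - x‖ + ‖x - y‖ : ℝ)‖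
      < ‖z - x‖ ∧
    ‖x - (‖y - z‖ * x + ‖z - x‖ * y + ‖x - y‖ * z) / (‖y - z‖ + ‖z - x‖ + ‖x - y‖ : ℝ)‖
      < ‖x - y‖ := by
  have c1 : ‖x - y‖ < ‖y - z‖ + ‖z - x‖ := by
    have := norm_add_lt_of_crs_ne_zero (a := y - z) (b := z - x) (by
      convert h using 1; simp [crs]; ring)
    rwa [sub_add_sub_cancel, norm_sub_rev] at this
  have c2 : ‖z - x‖ < ‖x - y‖ + ‖y - z‖ := by
    have := norm_add_lt_of_crs_ne_zero (a := x - y) (b := y - z) (by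
      convert h using 1; simp [crs]; ring)
    rwa [sub_add_sub_cancel, norm_sub_rev] at this
  have hb : 0 < ‖z - x‖ := norm_pos_iff.2 fun hb => h (by rw [hb]; simp [crs])
  have hc : 0 < ‖x - y‖ := norm_pos_iff.2 fun hc => h (by rw [← neg_sub, hc]; simp [crs])
  set a := ‖y - z‖ with ha
  set b := ‖z - x‖ with hbd
  set c := ‖x - y‖ with hcd
  have hs : 0 < a + b + c := by linarith
  have hle : ‖x - (a * x + b * y + c * z) / (a + b + c : ℝ)‖ ≤ 2 * b * c / (a + b + c) := by
    have hs' : ((a + b + c : ℝ) : ℂ) ≠ 0 := by exact_mod_cast hs.ne'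
    have : x - (a * x + b * y + c * z) / (a + b + c : ℝ)
        = (b * (x - y) + c * (x - z)) / (a + b + c : ℝ) := by
      rw [eq_div_iff hs', sub_mul, div_mul_cancel₀ _ hs']
      push_cast; ring
    rw [this, norm_div, Complex.norm_real, Real.norm_of_nonneg hs.le]
    refine div_le_div_of_nonneg_right ((norm_add_le _ _).trans ?_) hs.le
    rw [norm_mul, norm_mul, Complex.norm_real, Complex.norm_real, Real.norm_of_nonneg hb.le,
      Real.norm_of_nonneg hc.le, norm_sub_rev x z, ← hbd, ← hcd]
    linarith
  constructor
  · refine hle.trans_lt ?_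
    rw [div_lt_iff₀ hs]; nlinarith
  · refine hle.trans_lt ?_
    rw [div_lt_iff₀ hs]; nlinarith

/-- In the case of three leaves, the center of the star may be moved to the incenter. -/
lemma inP_three {φ : Fin 3 → ℝ} {q : Fin 3 → ℂ}
    (hexp : ∀ i, ∃ e, ∀ j, j ≠ i → dot e (q j) < dot e (q i))
    (hang : ∀ i j k, j ≠ i → k ≠ i → InnerProductGeometry.angle (q j - q i) (q k - q i) < φ i) :
    InP 3 φ := by
  have hcr : crs (q 1 - q 0) (q 2 - q 0) ≠ 0 := by
    refine crs_ne_zero_of_exposed ?_ ?_ ?_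
    · obtain ⟨e, he⟩ := hexp 0; exact ⟨e, he 1 (by decide), he 2 (by decide)⟩
    · obtain ⟨e, he⟩ := hexp 1; exact ⟨e, he 0 (by decide), he 2 (by decide)⟩
    · obtain ⟨e, he⟩ := hexp 2; exact ⟨e, he 0 (by decide), he 1 (by decide)⟩
  have hcr1 : crs (q 2 - q 1) (q 0 - q 1) ≠ 0 := by convert hcr using 1; simp [crs]; ring
  have hcr2 : crs (q 0 - q 2) (q 1 - q 2) ≠ 0 := by convert hcr using 1; simp [crs]; ring
  obtain ⟨l01, l02⟩ := norm_sub_incenter_lt hcr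
  obtain ⟨l11, l12⟩ := norm_sub_incenter_lt hcr1
  obtain ⟨l21, l22⟩ := norm_sub_incenter_lt hcr2
  have ha := (norm_nonneg _).trans_lt l12
  have hb := (norm_nonneg _).trans_lt l01
  have hc := (norm_nonneg _).trans_lt l02
  set a := ‖q 1 - q 2‖ with had
  set b := ‖q 2 - q 0‖ with hbd
  set c := ‖q 0 - q 1‖ with hcd
  have hs : 0 < a + b + c := by linarith
  set m := (a * q 0 + b * q 1 + c * q 2) / (a + b + c : ℝ) with hm
  have m1 : (b * q 1 + c * q 2 + a * q 0) / (b + c + a : ℝ) = m := by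
    rw [hm]; congr 1 <;> [ring; (congr 1; ring)]
  have m2 : (c * q 2 + a * q 0 + b * q 1) / (c + a + b : ℝ) = m := by
    rw [hm]; congr 1 <;> [ring; (congr 1; ring)]
  rw [m1] at l11 l12
  rw [m2] at l21 l22
  have hdot : ∀ e : ℂ, (a + b + c) * dot e m = a * dot e (q 0) + b * dot e (q 1) + c * dot e (q 2)
      := by
    intro e
    have hs' : ((a + b + c : ℝ) : ℂ) ≠ 0 := by exact_mod_cast hs.ne'
    have : ((a + b + c : ℝ) : ℂ) * m = a * q 0 + b * q 1 + c * q 2 := by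
      rw [hm]; field_simp
    rw [← dot_smul_right, this]
    simp only [dot_add_right, dot_smul_right]
  refine inP_of_points (by omega) (Q := fun i => q i - m) ?_ ?_ ?_ ?_
  · simp only [sub_sub_sub_cancel_right]
    have r01 : ‖q 1 - q 0‖ = c := norm_sub_rev _ _
    have r12 : ‖q 2 - q 1‖ = a := norm_sub_rev _ _
    have r20 : ‖q 0 - q 2‖ = b := norm_sub_rev _ _
    intro i j hij
    fin_cases i <;> fin_cases j <;> simp at hij ⊢ <;> linarith
  · intro i
    obtain ⟨e, he⟩ := hexp i
    refine ⟨e, ?_, fun j hj => ?_⟩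
    · have := hdot e
      rw [dot_sub_right]
      fin_cases i
      · have h1 := he 1 (by decide); have h2 := he 2 (by decide)
        simp only [Fin.zero_eta] at h1 h2 ⊢
        nlinarith
      · have h1 := he 0 (by decide); have h2 := he 2 (by decide)
        simp only [Fin.mk_one] at h1 h2 ⊢
        nlinarith
      · have h1 := he 0 (by decide); have h2 := he 1 (by decide)
        simp only [Fin.reduceFinMk] at h1 h2 ⊢
        nlinarith
    · rw [dot_sub_right, dot_sub_right]
      linarith [he j hj]
  · intro u hu
    by_contra! hcon
    have h0 := hcon 0
    have h1 := hcon 1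
    have h2 := hcon 2
    rw [dot_sub_right] at h0 h1 h2
    have hd := hdot u
    have e0 : dot u (q 0) - dot u m = 0 := by nlinarith
    have e1 : dot u (q 1) - dot u m = 0 := by nlinarith
    have e2 : dot u (q 2) - dot u m = 0 := by nlinarith
    have : dot u u * crs (q 1 - q 0) (q 2 - q 0) = (dot u (q 1) - dot u (q 0)) * crs u (q 2 - q 0)
        - (dot u (q 2) - dot u (q 0)) * crs u (q 1 - q 0) := by
      simp only [dot, crs, sub_re, sub_im]; ring
    rw [show dot u (q 1) - dot u (q 0) = 0 by linarith,
      show dot u (q 2) - dot u (q 0) = 0 by linarith, zero_mul, zero_mul, sub_zero] at this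
    exact (mul_ne_zero (dot_self_pos hu).ne' hcr) this
  · simpa only [sub_sub_sub_cancel_right] using hang

/-- Points as provided by a greedy drawing of the union of the trees yield a greedy drawing of the
star. -/
lemma inP_of_exposed {n : ℕ} (hn : 3 ≤ n) {φ : Fin n → ℝ} {q : Fin n → ℂ}
    (hstar : ∀ i j, i ≠ j → ‖q i‖ < ‖q i - q j‖)
    (hexp : ∀ i, ∃ e, 0 < dot e (q i) ∧ ∀ j, j ≠ i → dot e (q j) < dot e (q i))
    (hang : ∀ i j k, j ≠ i → k ≠ i → InnerProductGeometry.angle (q j - q i) (q k - q i) < φ i) :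
    InP n φ := by
  rcases eq_or_lt_of_le hn with rfl | hn
  · exact inP_three (fun i => (hexp i).imp fun _ h => h.2) hang
  · refine inP_of_points (by omega) hstar hexp
      (exists_dot_pos_of_star hn (fun i h => ?_) hstar) hang
    obtain ⟨e, he, -⟩ := hexp i
    rw [h, dot_zero_right] at he
    exact lt_irrefl _ he

open Filter Topology

/-! ### Drawing the union of the trees along a star -/

/-- What a star in the definition of `InP` provides: at each leaf `p i` there is a cone with sides
`u₁`, `u₂` and angle less than `φ i` which contains all other leaves and, in its interior, the
center `c`. -/
lemma InP.exists_cones {n : ℕ} (hn : 3 ≤ n) {φ : Fin n → ℝ} (h : InP n φ) :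
    ∃ (c : ℂ) (p : Fin n → ℂ), (∀ i, p i ≠ c) ∧
      (∀ i j, i ≠ j → dist c (p j) < dist (p i) (p j)) ∧
      ∀ i, ∃ (u₁ u₂ : ℂ) (ψ : ℝ), u₁ ≠ 0 ∧ HasTurn u₁ u₂ ψ ∧ 0 ≤ ψ ∧ ψ < φ i ∧ ψ < Real.pi ∧
        ∀ e, dot e u₁ < 0 → dot e u₂ < 0 →
          (∀ j, j ≠ i → dot e (p j - p i) < 0) ∧ dot e (c - p i) < 0 := by
  obtain ⟨Γ, hΓ, σ, hpoly, hint, hang⟩ := h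
  have hadj : ∀ i t, some i ≠ t → dist (Γ none) (Γ t) < dist (Γ (some i)) (Γ t) := by
    intro i t hit
    obtain ⟨u, hu, hlt⟩ := hΓ (some i) t hit
    rw [SimpleGraph.starGraph_adj] at hu
    obtain rfl : u = none := by simpa using hu.2
    exact hlt
  refine ⟨Γ none, fun i => Γ (some i), fun i hi => ?_, fun i j hij => hadj i _ (by simpa using hij),
    fun i => ?_⟩
  · have := hadj i none (by simp)
    rw [dist_self, dist_pos] at this
    exact this hi
  obtain ⟨k, rfl⟩ := σ.surjective i
  set P : Fin n → ℂ := fun k => Γ (some (σ k)) with hP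
  set k₁ := finRotate n k with hk₁
  set k₂ := (finRotate n).symm k with hk₂
  have hk₂' : finRotate n k₂ = k := Equiv.apply_symm_apply _ _
  have n₁ : k₁ ≠ k := finRotate_ne_self (by omega) k
  have n₂ : k₂ ≠ k := finRotate_symm_ne_self (by omega) k
  have n₁₂ : k₂ ≠ k₁ := by
    intro h
    rw [hk₁, ← hk₂'] at h
    obtain ⟨m, rfl⟩ : ∃ m, n = m + 3 := ⟨n - 3, by omega⟩
    rw [finRotate_apply, finRotate_apply, add_assoc] at h
    have h2 : (1 + 1 : Fin (m + 3)) = 0 := by simpa using h.symm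
    have := congrArg Fin.val h2
    simp only [Fin.val_add, Fin.val_one, Fin.val_zero] at this
    rw [Nat.mod_eq_of_lt (by omega)] at this
    omega
  set u₁ := P k₁ - P k with hu₁
  set u₂ := P k₂ - P k with hu₂
  have l₁ : ∀ j, j ≠ k → j ≠ k₁ → 0 < crs u₁ (P j - P k) := by
    intro j hj hj'
    rw [crs_eq_im]
    exact hpoly k j hj hj'
  have l₂ : ∀ j, j ≠ k → j ≠ k₂ → 0 < crs (P j - P k) u₂ := by
    intro j hj hj'
    have := hpoly k₂ j hj' (by rwa [hk₂'])
    rw [hk₂', ← crs_eq_im] at this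
    convert this using 1
    simp only [crs, hu₂, sub_re, sub_im, P]; ring
  have hD : 0 < crs u₁ u₂ := l₁ k₂ n₂ n₁₂
  have hu₁0 : u₁ ≠ 0 := by rintro h; rw [h] at hD; simp [crs] at hD
  have hu₂0 : u₂ ≠ 0 := by rintro h; rw [h] at hD; simp [crs] at hD
  have ht := hasTurn_ccwTurn hu₁0 hu₂0
  have hm := ccwTurn_mem u₁ u₂
  have hlt : ccwTurn u₁ u₂ < Real.pi := by
    rw [(hasTurn_self u₁).crs_pos_iff ht hu₁0, sub_zero] at hD
    by_contra hcon
    have := Real.sin_nonpos_of_nonpos_of_neg_pi_le (x := ccwTurn u₁ u₂ - 2 * Real.pi)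
      (by linarith [hm.2]) (by linarith)
    rw [Real.sin_sub_two_pi] at this
    linarith
  refine ⟨u₁, u₂, ccwTurn u₁ u₂, hu₁0, ht, hm.1, ?_, hlt, fun e he₁ he₂ => ?_⟩
  · have e1 : interiorAngle P k = InnerProductGeometry.angle u₂ u₁ := rfl
    have e2 := (hasTurn_self u₁).angle_eq ht hu₁0
      (by rw [zero_sub, abs_neg, abs_of_nonneg hm.1]; exact hlt.le)
    rw [zero_sub, abs_neg, abs_of_nonneg hm.1, InnerProductGeometry.angle_comm] at e2
    rw [← e2, ← e1]
    exact hang k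
  have hall : ∀ j, j ≠ k → dot e (P j - P k) < 0 := by
    intro j hj
    by_cases hj₁ : j = k₁
    · rw [hj₁]; exact he₁
    by_cases hj₂ : j = k₂
    · rw [hj₂]; exact he₂
    have e2 : crs u₁ u₂ * dot e (P j - P k)
        = crs (P j - P k) u₂ * dot e u₁ + crs u₁ (P j - P k) * dot e u₂ := by
      simp only [crs, dot]; ring
    have := l₁ j hj hj₁
    have := l₂ j hj hj₂
    nlinarith
  refine ⟨fun j hj => ?_, ?_⟩
  · have := hall (σ.symm j) (fun h => hj (by rw [← h, Equiv.apply_symm_apply]))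
    simpa [P] using this
  · have hhalf : convexHull ℝ (Set.range P) ⊆ {z | dot e z ≤ dot e (P k)} := by
      refine convexHull_min ?_ ?_
      · rintro _ ⟨j, rfl⟩
        rcases eq_or_ne j k with rfl | hj
        · exact le_refl (dot e (P j))
        · have := hall j hj
          rw [dot_sub_right] at this
          show dot e (P j) ≤ _
          linarith
      · exact convex_halfSpace_le (f := dot e)
          ⟨fun x y => dot_add_right e x y, fun t x => by
            rw [Complex.real_smul, dot_smul_right, smul_eq_mul]⟩ _
    have he : e ≠ 0 := by rintro rfl; simp [dot] at he₁
    -- a small step from the center in direction `e` stays in the polygon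
    have hlim : Tendsto (fun t : ℝ => Γ none + t * e) (𝓝[>] 0) (𝓝 (Γ none)) := by
      have : Continuous fun t : ℝ => Γ none + t * e := by fun_prop
      have := this.tendsto 0
      simp only [ofReal_zero, zero_mul, add_zero] at this
      exact this.mono_left nhdsWithin_le_nhds
    obtain ⟨t, ht1, ht2⟩ := ((hlim.eventually
      (mem_interior_iff_mem_nhds.1 hint)).and self_mem_nhdsWithin).exists
    have h1 : dot e (Γ none + t * e) ≤ dot e (P k) := hhalf ht1
    rw [dot_add_right, dot_smul_right] at h1
    have := mul_pos (show 0 < t from ht2) (dot_self_pos he)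
    show dot e (Γ none - P k) < 0
    rw [dot_sub_right]
    linarith

lemma IsGreedy.mul_sub {W : Type*} {H : SimpleGraph W} {F : W → ℂ} (h : IsGreedy H F) {ρ : ℂ}
    (hρ : ρ ≠ 0) (a : ℂ) : IsGreedy H (fun x => ρ * (F x - a)) := by
  intro s t hst
  obtain ⟨u, hu, hlt⟩ := h s t hst
  refine ⟨u, hu, ?_⟩
  simp only [dist_eq_norm, ← _root_.mul_sub, sub_sub_sub_cancel_right, norm_mul] at hlt ⊢
  exact mul_lt_mul_of_pos_left hlt (norm_pos_iff.2 hρ)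

lemma IsGreedy.ne {W : Type*} {H : SimpleGraph W} {F : W → ℂ} (h : IsGreedy H F) {s t : W}
    (hst : s ≠ t) : F s ≠ F t := by
  obtain ⟨u, -, hlt⟩ := h s t hst
  exact dist_pos.1 (dist_nonneg.trans_lt hlt)

lemma HasTurn.mul_left {d w : ℂ} {s : ℝ} (h : HasTurn d w s) (ρ : ℂ) :
    HasTurn (ρ * d) (ρ * w) s := by
  obtain ⟨k, hk, rfl⟩ := h
  exact ⟨k, hk, by ring⟩

section OpeningAngle

variable {W : Type*} {H : SimpleGraph W} {r v : W} {F : W → ℂ}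

/-- A drawing of a rooted tree with opening angle greater than `ψ` can be rotated such that the
half-plane of each edge contains a given cone of angle `ψ`, up to translation. -/
lemma exists_rotation_of_lt_openingAngle [Finite W] (hF : IsGreedy H F) (hrv : r ≠ v)
    {u₁ u₂ : ℂ} {ψ : ℝ}
    (hu : u₁ ≠ 0) (hψ : HasTurn u₁ u₂ ψ) (hψ0 : 0 ≤ ψ) (hlt : ψ < openingAngle H r v F)
    (hpi : openingAngle H r v F < Real.pi) :
    ∃ ρ : ℂ, ρ ≠ 0 ∧ ∀ s t, (s, t) ∈ awayEdges H r v →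
      dot (ρ * (F t - F s)) u₁ < 0 ∧ dot (ρ * (F t - F s)) u₂ < 0 := by
  unfold openingAngle at hlt hpi
  split_ifs at hlt hpi with hne
  swap
  · exact absurd hpi (lt_irrefl _)
  obtain ⟨ρ, hρ, h⟩ := exists_rotation (sub_ne_zero.2 (hF.ne hrv)) hu hψ hψ0 hlt (by linarith)
  refine ⟨ρ, hρ, fun s t hst => h _ (sub_ne_zero.2 (hF.ne hst.1.ne')) ?_ ?_⟩
  · exact csInf_le (Set.toFinite _).bddBelow ⟨_, hst, rfl⟩
  · exact csInf_le (Set.toFinite _).bddBelow ⟨_, hst, rfl⟩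

/-- The opening angle does not grow if all edges but the root edge are rotated and scaled by the same
factor and the root edge changes its direction, as long as the root remains in the half-planes of
all other edges. -/
lemma openingAngle_le_of_away_eq [Finite W] (hF : IsGreedy H F) (hrv : r ≠ v) {Γ : W → ℂ}
    {ρ : ℂ} (hρ : ρ ≠ 0)
    (h0 : 0 < openingAngle H r v F) (hpi : openingAngle H r v F < Real.pi)
    (hΓ : ∀ s t, (s, t) ∈ awayEdges H r v → Γ t - Γ s = ρ * (F t - F s))
    (hneg : ∀ s t, (s, t) ∈ awayEdges H r v → dot (Γ t - Γ s) (Γ r - Γ v) < 0) :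
    openingAngle H r v Γ ≤ openingAngle H r v F := by
  have hd := sub_ne_zero.2 (hF.ne hrv)
  unfold openingAngle at h0 hpi ⊢
  split_ifs at h0 hpi ⊢ with hne
  swap
  · exact le_rfl
  obtain ⟨⟨s₁, t₁⟩, h₁, e₁⟩ := (hne.image
    (fun e : W × W => ccwTurn (F e.2 - F e.1) (F r - F v))).csInf_mem (Set.toFinite _)
  obtain ⟨⟨s₂, t₂⟩, h₂, e₂⟩ := (hne.image
    (fun e : W × W => ccwTurn (F r - F v) (F e.2 - F e.1))).csInf_mem (Set.toFinite _)
  rw [← e₁, ← e₂] at h0 hpi ⊢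
  simp only at h0 hpi ⊢
  have T₁ := ((hasTurn_ccwTurn (sub_ne_zero.2 (hF.ne h₁.1.ne')) hd).symm).mul_left ρ
  have T₂ := (hasTurn_ccwTurn hd (sub_ne_zero.2 (hF.ne h₂.1.ne'))).mul_left ρ
  have g₁ := hneg _ _ h₁
  have g₂ := hneg _ _ h₂
  have key := ccwTurn_add_ccwTurn_eq (mul_ne_zero hρ hd) T₁ T₂ (by linarith) (by linarith)
    (by rw [← hΓ _ _ h₁]; exact g₁) (by rw [← hΓ _ _ h₂]; exact g₂)
  simp only at key
  rw [← key, ← hΓ _ _ h₁, ← hΓ _ _ h₂]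
  gcongr
  · exact csInf_le (Set.toFinite _).bddBelow ⟨_, h₁, rfl⟩
  · exact csInf_le (Set.toFinite _).bddBelow ⟨_, h₂, rfl⟩

/-- A tree with at most one edge besides the root edge is a path, drawn here on the real axis. -/
lemma isGreedy_dist_of_subsingleton (hc : H.Connected) (hrv : H.Adj r v)
    (hdeg : ∀ w, H.Adj r w → w = v) (hsub : (awayEdges H r v).Subsingleton) :
    IsGreedy H (fun x => (H.dist r x : ℂ)) := by
  have hd1 := SimpleGraph.dist_eq_one_iff_adj.2 hrv
  have hcases : ∀ x, x = r ∨ x = v ∨ (RootedEdge H r v x ∧ (v, x) ∈ awayEdges H r v) := by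
    intro x
    by_cases hx : x = r
    · exact Or.inl hx
    obtain ⟨p, hp⟩ := exists_parent hc hx
    by_cases hpr : p = r
    · exact Or.inr (Or.inl (hdeg x (hpr ▸ hp.1)))
    have hpx : (p, x) ∈ awayEdges H r v :=
      mem_awayEdges_iff.2 ⟨hp, fun h => hpr (Prod.ext_iff.1 h).1⟩
    obtain ⟨q, hq⟩ := exists_parent hc hpr
    by_cases hqr : q = r
    · have hpv := hdeg p (hqr ▸ hq.1)
      subst hpv
      exact Or.inr (Or.inr ⟨hp, hpx⟩)
    · have hqp : (q, p) ∈ awayEdges H r v :=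
        mem_awayEdges_iff.2 ⟨hq, fun h => hqr (Prod.ext_iff.1 h).1⟩
      exact absurd (Prod.ext_iff.1 (hsub hpx hqp)).2 hp.1.ne'
  have h2 : ∀ {x}, RootedEdge H r v x → H.dist r x = 2 := fun h => by
    rw [h.dist_eq hc, hd1]
  intro s t hst
  rcases hcases s with rfl | rfl | ⟨hs, hs'⟩ <;> rcases hcases t with rfl | rfl | ⟨ht, ht'⟩
  · exact absurd rfl hst
  · exact ⟨_, hrv, by simp [hd1]⟩
  · exact ⟨v, hrv, by simp [hd1, h2 ht, Complex.dist_eq]; norm_num⟩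
  · exact ⟨_, hrv.symm, by simp [hd1]⟩
  · exact absurd rfl hst
  · exact ⟨t, ht.1, by simp [hd1, h2 ht, Complex.dist_eq]; norm_num⟩
  · exact ⟨v, hs.1.symm, by simp [hd1, h2 hs]⟩
  · exact ⟨_, hs.1.symm, by simp [hd1, h2 hs, Complex.dist_eq]; norm_num⟩
  · exact absurd (Prod.ext_iff.1 (hsub hs' ht')).2 hst

/-- The drawing of a path on the real axis can be rotated to fit any cone of angle less
than `π`. -/
lemma exists_rotation_of_subsingleton (hc : H.Connected) {u₁ u₂ : ℂ} {ψ : ℝ}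
    (hu : u₁ ≠ 0) (hψ : HasTurn u₁ u₂ ψ) (hψ0 : 0 ≤ ψ) (hpi : ψ < Real.pi) :
    ∃ ρ : ℂ, ρ ≠ 0 ∧ ∀ s t, (s, t) ∈ awayEdges H r v →
      dot (ρ * ((H.dist r t : ℂ) - H.dist r s)) u₁ < 0 ∧
      dot (ρ * ((H.dist r t : ℂ) - H.dist r s)) u₂ < 0 := by
  have hπ := Real.pi_pos
  have h1 : HasTurn 1 (-1) Real.pi := ⟨1, one_pos, by simp⟩
  have h2 : HasTurn (-1) 1 Real.pi := ⟨1, one_pos, by simp⟩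
  obtain ⟨ρ, hρ, h⟩ := exists_rotation (d := -1) (A := (3 * Real.pi + ψ) / 4)
    (B := (3 * Real.pi + ψ) / 4) (by simp) hu hψ hψ0 (by linarith) (by linarith)
  refine ⟨ρ, hρ, fun s t hst => ?_⟩
  have e : (H.dist r t : ℂ) - H.dist r s = 1 := by
    rw [(mem_awayEdges_iff.1 hst).1.dist_eq hc]; push_cast; ring
  rw [e]
  refine h 1 one_ne_zero ?_ ?_
  · rw [h2.ccwTurn_eq (by simp) hπ.le (by linarith)]; linarith
  · rw [h1.ccwTurn_eq (by simp) hπ.le (by linarith)]; linarith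

end OpeningAngle

namespace IsRootedUnion

variable {V : Type*} {G : SimpleGraph V} {n : ℕ} {T : Fin n → G.Subgraph} {r : V} {v : Fin n → V}

lemma exists_mem (U : IsRootedUnion T r v) (x : V) : ∃ i, x ∈ (T i).verts := by
  have h : x ∈ (⨆ i, T i).verts := by rw [U.union]; trivial
  simpa using h

/-- Functions on the trees without their root extend to the union. -/
lemma exists_extension (U : IsRootedUnion T r v) (c : ℂ) (z : ∀ i, (T i).verts → ℂ) :
    ∃ b : V → ℂ, b r = c ∧ ∀ i (x : (T i).verts), (x : V) ≠ r → b x = z i x := by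
  classical
  choose ι hι using U.exists_mem
  refine ⟨fun x => if x = r then c else z (ι x) ⟨x, hι x⟩, by simp, ?_⟩
  rintro i ⟨x, hxi⟩ hx
  have hi : ι x = i := by
    by_contra hne
    exact hx (U.eq_root hne (hι x) hxi)
  subst hi
  exact if_neg hx

/-- If the nodes of each tree other than the root are drawn close to the leaf `p i` of a greedily
drawn star with center `c`, at a small scale, then the drawing of the union is greedy provided that
the half-planes of the edges contain the center and the other leaves. -/
lemma exists_isGreedy [Finite V] (U : IsRootedUnion T r v) {c : ℂ} {p : Fin n → ℂ}
    (hpc : ∀ i, p i ≠ c) (hp : ∀ i j, i ≠ j → dist c (p j) < dist (p i) (p j))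
    {z : ∀ i, (T i).verts → ℂ} (hz : ∀ i, IsGreedy (T i).coe (z i))
    (haway : ∀ i s t, (s, t) ∈ awayEdges (T i).coe ⟨r, U.root_mem i⟩ ⟨v i, (U.adj i).snd_mem⟩ →
      (∀ j, j ≠ i → dot (z i t - z i s) (p j - p i) < 0) ∧ dot (z i t - z i s) (c - p i) < 0) :
    ∃ (Γ : V → ℂ) (ε : ℝ), 0 < ε ∧ IsGreedy G Γ ∧ Γ r = c ∧
      ∀ i (x : (T i).verts), (x : V) ≠ r → Γ x = p i + ε * z i x := by
  obtain ⟨a, ar, ha⟩ := U.exists_extension c fun i _ => p i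
  obtain ⟨b, br, hb⟩ := U.exists_extension 0 z
  suffices h : ∀ᶠ ε : ℝ in 𝓝[>] 0, IsGreedy G fun x => a x + ε * b x by
    obtain ⟨ε, h1, h2⟩ := (h.and self_mem_nhdsWithin).exists
    exact ⟨_, ε, h2, h1, by simp [ar, br], fun i x hx => by simp only [ha i x hx, hb i x hx]⟩
  suffices h : ∀ s t, s ≠ t → ∃ u, G.Adj s u ∧ ∀ᶠ ε : ℝ in 𝓝[>] 0,
      dist (a u + ε * b u) (a t + ε * b t) < dist (a s + ε * b s) (a t + ε * b t) by
    have h' : ∀ᶠ ε : ℝ in 𝓝[>] 0, ∀ s t, s ≠ t → ∃ u, G.Adj s u ∧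
        dist (a u + ε * b u) (a t + ε * b t) < dist (a s + ε * b s) (a t + ε * b t) := by
      refine eventually_all.2 fun s => eventually_all.2 fun t => ?_
      rcases eq_or_ne s t with rfl | hst
      · exact Eventually.of_forall fun _ h => absurd rfl h
      · obtain ⟨u, hu, h⟩ := h s t hst
        exact h.mono fun ε h _ => ⟨u, hu, h⟩
    exact h'
  have near : ∀ s t u, dist (a u) (a t) < dist (a s) (a t) → ∀ᶠ ε : ℝ in 𝓝[>] 0,
      dist (a u + ε * b u) (a t + ε * b t) < dist (a s + ε * b s) (a t + ε * b t) := by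
    intro s t u h
    have ho : IsOpen {ε : ℝ | dist (a u + ε * b u) (a t + ε * b t)
        < dist (a s + ε * b s) (a t + ε * b t)} := isOpen_lt (by fun_prop) (by fun_prop)
    exact nhdsWithin_le_nhds (ho.mem_nhds (by simpa using h))
  intro s t hst
  rcases eq_or_ne s r with rfl | hsr
  · -- the node is the root
    obtain ⟨i, hi⟩ := U.exists_mem t
    refine ⟨v i, (U.adj i).adj_sub, near _ _ _ ?_⟩
    rw [ha i ⟨t, hi⟩ hst.symm, ha i ⟨v i, (U.adj i).snd_mem⟩ (U.adj i).ne.symm, ar, dist_self,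
      dist_pos]
    exact (hpc i).symm
  obtain ⟨i, hi⟩ := U.exists_mem s
  have as := ha i ⟨s, hi⟩ hsr
  have bs := hb i ⟨s, hi⟩ hsr
  simp only at as bs
  by_cases hti : t ∈ (T i).verts ∧ t ≠ r
  · -- both nodes are in the same tree
    obtain ⟨hti, htr⟩ := hti
    obtain ⟨u, hu, hlt⟩ := hz i ⟨s, hi⟩ ⟨t, hti⟩ (fun h => hst (congrArg Subtype.val h))
    have hur : (u : V) ≠ r := by
      -- no node of the tree is closer to the root than to the neighbour of the root
      intro hur
      obtain rfl : u = ⟨r, U.root_mem i⟩ := Subtype.ext hur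
      obtain ⟨u', hu', hlt'⟩ := hz i ⟨r, U.root_mem i⟩ ⟨t, hti⟩
        (fun h => htr (congrArg Subtype.val h).symm)
      have e1 := U.deg i _ hu'
      have e2 := U.deg i _ (show (T i).Adj r s from (show (T i).Adj s r from hu).symm)
      have : u' = ⟨s, hi⟩ := Subtype.ext (e1.trans e2.symm)
      rw [this] at hlt'
      exact lt_asymm hlt hlt'
    refine ⟨u, (show (T i).Adj s u from hu).adj_sub, ?_⟩
    filter_upwards [self_mem_nhdsWithin] with ε hε
    have hε' : (0 : ℝ) < ε := hε
    rw [as, bs, ha i u hur, hb i u hur, ha i ⟨t, hti⟩ htr, hb i ⟨t, hti⟩ htr, dist_add_left,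
      dist_add_left, dist_eq_norm, dist_eq_norm, ← _root_.mul_sub, ← _root_.mul_sub, norm_mul,
      norm_mul, ← dist_eq_norm, ← dist_eq_norm]
    exact mul_lt_mul_of_pos_left hlt (by simpa using hε'.ne')
  -- the drawing of the second node is near the center or near another leaf
  have hat : a t = c ∨ ∃ j, j ≠ i ∧ a t = p j := by
    by_cases htr : t = r
    · exact Or.inl (htr ▸ ar)
    · obtain ⟨j, hj⟩ := U.exists_mem t
      exact Or.inr ⟨j, fun h => hti ⟨h ▸ hj, htr⟩, ha j ⟨t, hj⟩ htr⟩
  by_cases hsv : s = v i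
  · refine ⟨r, by rw [hsv]; exact (U.adj i).adj_sub.symm, near _ _ _ ?_⟩
    rw [ar, as]
    rcases hat with h | ⟨j, hj, h⟩
    · rw [h, dist_self, dist_pos]; exact hpc i
    · rw [h]; exact hp i j hj.symm
  obtain ⟨u, hu⟩ := exists_parent (U.tree i).connected (r := ⟨r, U.root_mem i⟩) (t := ⟨s, hi⟩)
    (fun h => hsr (congrArg Subtype.val h))
  have hur : (u : V) ≠ r := fun h => hsv (U.deg i s (by
    have := hu.1
    rw [show u = ⟨r, U.root_mem i⟩ from Subtype.ext h] at this
    exact this))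
  have hneg : dot (z i ⟨s, hi⟩ - z i u) (a t - p i) < 0 := by
    have := haway i u ⟨s, hi⟩ (mem_awayEdges_iff.2 ⟨hu, fun h => hur
      (congrArg Subtype.val (Prod.ext_iff.1 h).1)⟩)
    rcases hat with h | ⟨j, hj, h⟩
    · rw [h]; exact this.2
    · rw [h]; exact this.1 j hj
  -- the parent is closer for small `ε`, as the comparison tends to `hneg`
  refine ⟨u, (show (T i).Adj u s from hu.1).adj_sub.symm, ?_⟩
  have ho : IsOpen {ε : ℝ | dot (z i ⟨s, hi⟩ - z i u)
      (a t + ε * b t - (p i + ε * z i u + (p i + ε * z i ⟨s, hi⟩)) / 2) < 0} :=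
    isOpen_lt ((continuous_dot _).comp (by fun_prop)) continuous_const
  have hev : ∀ᶠ ε : ℝ in 𝓝[>] 0, dot (z i ⟨s, hi⟩ - z i u)
      (a t + ε * b t - (p i + ε * z i u + (p i + ε * z i ⟨s, hi⟩)) / 2) < 0 :=
    nhdsWithin_le_nhds (ho.mem_nhds (by simpa using hneg))
  filter_upwards [hev, self_mem_nhdsWithin] with ε h hε
  rw [ha i u hur, hb i u hur, as, bs, dist_lt_dist_iff_dot, add_sub_add_left_eq_sub,
    ← _root_.mul_sub, dot_smul_left]
  exact mul_neg_of_pos_of_neg hε h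

lemma awayEdges_subsingleton [Finite V] (U : IsRootedUnion T r v) {i : Fin n}
    (h : (T i).edgeSet.ncard ≤ 2) :
    (awayEdges (T i).coe ⟨r, U.root_mem i⟩ ⟨v i, (U.adj i).snd_mem⟩).Subsingleton := by
  rintro ⟨s, t⟩ hst ⟨s', t'⟩ hst'
  by_contra hne
  obtain ⟨h1, h2⟩ := mem_awayEdges_iff.1 hst
  obtain ⟨h1', h2'⟩ := mem_awayEdges_iff.1 hst'
  have inj : ∀ {a b a' b' : (T i).verts}, RootedEdge (T i).coe ⟨r, U.root_mem i⟩ a b →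
      RootedEdge (T i).coe ⟨r, U.root_mem i⟩ a' b' → (a, b) ≠ (a', b') →
      s((a : V), (b : V)) ≠ s((a' : V), (b' : V)) := by
    intro a b a' b' hab hab' hne h
    rcases Sym2.eq_iff.1 h with ⟨e1, e2⟩ | ⟨e1, e2⟩
    · exact hne (Prod.ext (Subtype.ext e1) (Subtype.ext e2))
    · rw [Subtype.ext e1, Subtype.ext e2] at hab
      exact lt_asymm hab.2 hab'.2
  have : 2 < (T i).edgeSet.ncard := by
    rw [Set.two_lt_ncard_iff (Set.toFinite _)]
    exact ⟨_, _, _, SimpleGraph.Subgraph.mem_edgeSet.2 (U.adj i),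
      SimpleGraph.Subgraph.mem_edgeSet.2 (show (T i).Adj s t from h1.1),
      SimpleGraph.Subgraph.mem_edgeSet.2 (show (T i).Adj s' t' from h1'.1),
      inj (U.rootedEdge i) h1 h2.symm, inj (U.rootedEdge i) h1' h2'.symm, inj h1 h1' hne⟩
  omega

/-- A drawing of the tree `T i` that fits into the cone at a leaf of the star. -/
lemma exists_fitting_drawing [Finite V] (U : IsRootedUnion T r v) {i : Fin n} {u₁ u₂ : ℂ} {φ ψ : ℝ}
    (hu : u₁ ≠ 0) (hψ : HasTurn u₁ u₂ ψ) (hψ0 : 0 ≤ ψ) (hψφ : ψ < φ) (hφ : φ ≤ Real.pi)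
    (hlong : 2 < (T i).edgeSet.ncard → ∀ ε : ℝ, 0 < ε → ∃ Γ : (T i).verts → ℂ,
      IsGreedy (T i).coe Γ ∧ φ - ε ≤ subtreeAngle (T i) (U.adj i) Γ ∧
        subtreeAngle (T i) (U.adj i) Γ < φ) :
    ∃ z : (T i).verts → ℂ, IsGreedy (T i).coe z ∧ z ⟨v i, (U.adj i).snd_mem⟩ = 0 ∧
      (∀ s t, (s, t) ∈ awayEdges (T i).coe ⟨r, U.root_mem i⟩ ⟨v i, (U.adj i).snd_mem⟩ →
        dot (z t - z s) u₁ < 0 ∧ dot (z t - z s) u₂ < 0) ∧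
      (2 < (T i).edgeSet.ncard → ∀ (Γ : (T i).verts → ℂ) (ε : ℝ), 0 < ε →
        (∀ s t, (s, t) ∈ awayEdges (T i).coe ⟨r, U.root_mem i⟩ ⟨v i, (U.adj i).snd_mem⟩ →
          Γ t - Γ s = ε * (z t - z s) ∧
          dot (Γ t - Γ s) (Γ ⟨r, U.root_mem i⟩ - Γ ⟨v i, (U.adj i).snd_mem⟩) < 0) →
        subtreeAngle (T i) (U.adj i) Γ < φ) := by
  have hrv : (⟨r, U.root_mem i⟩ : (T i).verts) ≠ ⟨v i, (U.adj i).snd_mem⟩ :=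
    fun h => (U.adj i).ne (congrArg Subtype.val h)
  by_cases hcard : 2 < (T i).edgeSet.ncard
  · obtain ⟨F, hF, hF1, hF2⟩ := hlong hcard ((φ - ψ) / 2) (by linarith)
    have h1 : ψ < openingAngle (T i).coe ⟨r, U.root_mem i⟩ ⟨v i, (U.adj i).snd_mem⟩ F :=
      lt_of_lt_of_le (by linarith) hF1
    have h2 := hF2.trans_le hφ
    obtain ⟨ρ, hρ, h⟩ := exists_rotation_of_lt_openingAngle hF hrv hu hψ hψ0 h1 h2
    refine ⟨_, hF.mul_sub hρ (F ⟨v i, (U.adj i).snd_mem⟩), by simp, fun s t hst => ?_,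
      fun _ Γ ε hε hΓ => ?_⟩
    · rw [← _root_.mul_sub, sub_sub_sub_cancel_right]
      exact h s t hst
    · refine lt_of_le_of_lt (openingAngle_le_of_away_eq (ρ := ε * ρ) hF hrv
        (mul_ne_zero (by exact_mod_cast hε.ne') hρ) (hψ0.trans_lt h1) h2 (fun s t hst => ?_)
        fun s t hst => (hΓ s t hst).2) hF2
      rw [(hΓ s t hst).1]; ring
  · have hc := (U.tree i).connected
    obtain ⟨ρ, hρ, h⟩ := exists_rotation_of_subsingleton (H := (T i).coe)
      (r := ⟨r, U.root_mem i⟩) (v := ⟨v i, (U.adj i).snd_mem⟩) hc hu hψ hψ0 (hψφ.trans_le hφ)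
    refine ⟨_, (isGreedy_dist_of_subsingleton hc (U.rootedEdge i).1
      (fun w hw => Subtype.ext (U.deg i w hw))
      (U.awayEdges_subsingleton (not_lt.1 hcard))).mul_sub hρ
      ((T i).coe.dist ⟨r, U.root_mem i⟩ ⟨v i, (U.adj i).snd_mem⟩ : ℂ), by simp, fun s t hst => ?_,
      fun h => absurd h hcard⟩
    rw [← _root_.mul_sub, sub_sub_sub_cancel_right]
    exact h s t hst

lemma exists_isGreedy_of_inP [Finite V] (U : IsRootedUnion T r v) (hn : 3 ≤ n) {φ : Fin n → ℝ}
    (hφ : ∀ i, φ i ≤ Real.pi)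
    (hlong : ∀ i, 2 < (T i).edgeSet.ncard → ∀ ε : ℝ, 0 < ε → ∃ Γ : (T i).verts → ℂ,
      IsGreedy (T i).coe Γ ∧ φ i - ε ≤ subtreeAngle (T i) (U.adj i) Γ ∧
        subtreeAngle (T i) (U.adj i) Γ < φ i) (h : InP n φ) :
    ∃ Γ : V → ℂ, IsGreedy G Γ ∧ ∀ i, 2 < (T i).edgeSet.ncard →
      subtreeAngle (T i) (U.adj i) (fun x => Γ x) < φ i := by
  obtain ⟨c, p, hpc, hp, hcone⟩ := h.exists_cones hn
  choose u₁ u₂ ψ hu hψ hψ0 hψφ _ hall using hcone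
  choose z hz hzv hneg hang using fun i =>
    U.exists_fitting_drawing (hu i) (hψ i) (hψ0 i) (hψφ i) (hφ i) (hlong i)
  obtain ⟨Γ, ε, hε, hΓ, hr, hx⟩ := U.exists_isGreedy hpc hp hz fun i s t hst =>
    hall i _ (hneg i s t hst).1 (hneg i s t hst).2
  refine ⟨Γ, hΓ, fun i hi => hang i hi _ ε hε fun s t hst => ?_⟩
  obtain ⟨h1, h2⟩ := mem_awayEdges_iff.1 hst
  have hs : (s : V) ≠ r := by
    intro h
    obtain rfl : s = ⟨r, U.root_mem i⟩ := Subtype.ext h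
    exact h2 (Prod.ext rfl (Subtype.ext (U.deg i t h1.1)))
  have ht : (t : V) ≠ r := by
    intro h
    obtain rfl : t = ⟨r, U.root_mem i⟩ := Subtype.ext h
    have := h1.2
    rw [SimpleGraph.dist_self] at this
    omega
  have hv := hx i ⟨v i, (U.adj i).snd_mem⟩ (U.adj i).ne.symm
  rw [hzv, mul_zero, add_zero] at hv
  have e : Γ t - Γ s = ε * (z i t - z i s) := by rw [hx i t ht, hx i s hs]; ring
  refine ⟨e, ?_⟩
  show dot (Γ t - Γ s) (Γ r - Γ (v i)) < 0
  rw [e, dot_smul_left, hr, hv]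
  exact mul_neg_of_pos_of_neg hε (hall i _ (hneg i s t hst).1 (hneg i s t hst).2).2

end IsRootedUnion

end GreedyTree

theorem mainTheorem1
    {V : Type*} [Finite V] (G : SimpleGraph V) (n : ℕ) (hn : n = 3 ∨ n = 4 ∨ n = 5)
    -- the trees `T i` with common root `r` and root edge `r (v i)`, and their union `G`
    (T : Fin n → G.Subgraph) (r : V) (v : Fin n → V)
    (htree : ∀ i, (T i).coe.IsTree)
    (hrv : ∀ i, (T i).Adj r (v i))
    (hdeg : ∀ i w, (T i).Adj r w → w = v i)
    (hinter : ∀ i j, i ≠ j → (T i).verts ∩ (T j).verts = {r})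
    (hunion : ⨆ i, T i = ⊤)
    (φ : Fin n → ℝ) (hφ : ∀ i, 0 < φ i ∧ φ i ≤ Real.pi)
    -- a tree with one or two edges has opening angle `π` in each greedy drawing
    (hshort : ∀ i, (T i).edgeSet.ncard ≤ 2 → φ i = Real.pi)
    (hlong : ∀ i, 2 < (T i).edgeSet.ncard → ∀ ε : ℝ, 0 < ε →
      ∃ Γ : (T i).verts → ℂ, GreedyTree.IsGreedy (T i).coe Γ ∧
        φ i - ε ≤ GreedyTree.subtreeAngle (T i) (hrv i) Γ ∧
        GreedyTree.subtreeAngle (T i) (hrv i) Γ < φ i) :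
    (∃ Γ : V → ℂ, GreedyTree.IsGreedy G Γ ∧
      ∀ i, 2 < (T i).edgeSet.ncard →
        GreedyTree.subtreeAngle (T i) (hrv i) (fun x => Γ x) < φ i) ↔
    GreedyTree.InP n φ := by
  have U : GreedyTree.IsRootedUnion T r v := ⟨htree, hrv, hdeg, hinter, hunion⟩
  have hn3 : 3 ≤ n := by omega
  constructor
  · rintro ⟨Γ, hΓ, hang⟩
    obtain ⟨q, h1, h2, h3⟩ := U.exists_points hΓ hφ fun i =>
      (le_or_gt (T i).edgeSet.ncard 2).imp (hshort i) (hang i)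
    exact GreedyTree.inP_of_exposed hn3 h1 h2 h3
  · exact U.exists_isGreedy_of_inP hn3 (fun i => (hφ i).2) hlong
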